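/- Theorem. There is a universal constant $C>0$ such that the following holds. Let $n\ge 0$, $D=2^n$, $M\ge 2$, let $O_1,\dots,O_M$ be Hermitian $D\times D$ matrices, put $B=\max_i \mathrm{tr}(O_i^2)$, and let $\epsilon,\delta\in(0,1]$. Then there are a number of copies $$N \;\le\; C\,\log\frac{2}{\delta}\cdot\min\left(\frac{B\log M}{\epsilon^2},\ \frac{B^2D}{\epsilon^4}\log^+\frac{\sqrt B}{\epsilon},\ \frac{BD^2}{\epsilon^2}\log^+\frac{\sqrt{BD}}{\epsilon}\right),\qquad \log^+ x=\max(0,\log x),$$ and a protocol, i.e. a map $(s_1,\dots,s_N)\mapsto(\hat o_1,\dots,\hat o_M)\in\mathbb R^M$ that does not depend on the unknown state, such that for every $n$-qubit state (density matrix) $\rho$: if $s_1,\dots,s_N$ are the outcomes of independent stabilizer measurements on $N$ copies of $\rho$, then with probability at least $1-\delta$ $$|\hat o_i-\mathrm{tr}(O_i\rho)|\le\epsilon\quad\text{for all } 1\le i\le M.$$ Here an $n$-qubit stabilizer state is a state $C|b\rangle$ (up to global phase), where $|b\rangle$ is a computational basis state and $C$ is in the Clifford group, generated by CNOT, Hadamard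 and phase gates; $\mathrm{STAB}$ is the finite set of these states, and the stabilizer measurement is the POVM $\{\tfrac{2^n}{|\mathrm{STAB}|}|s\rangle\langle s| : s\in\mathrm{STAB}\}$, with outcome probabilities $\tfrac{2^n}{|\mathrm{STAB}|}\langle s|\rho|s\rangle$. -/

import Mathlib

open MeasureTheory
open scoped ComplexOrder

/-- Labels of the computational basis of `n` qubits: bit strings of length `n`. -/
abbrev Bits (n : ℕ) : Type := Fin n → ZMod 2

/-- Complex `2 ^ n × 2 ^ n` matrices, indexed by bit strings. -/
abbrev QMat (n : ℕ) : Type := Matrix (Bits n) (Bits n) ℂ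

/-- The sign `(-1) ^ z` of a bit `z`. -/
noncomputable def bitSign (z : ZMod 2) : ℂ := (-1) ^ z.val

/-- The Hadamard gate on qubit `j` (identity on the other qubits). -/
noncomputable def hadamardMat {n : ℕ} (j : Fin n) : QMat n :=
  Matrix.of fun x y =>
    if ∀ k, k ≠ j → x k = y k then ((1 / Real.sqrt 2 : ℝ) : ℂ) * bitSign (x j * y j) else 0

/-- The phase gate `diag (1, i)` on qubit `j`. -/
noncomputable def phaseMat {n : ℕ} (j : Fin n) : QMat n :=
  Matrix.diagonal fun x => Complex.I ^ (x j).val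

/-- The CNOT gate with control `c` and target `t`: it maps `|y⟩` to `|y + y_c e_t⟩`. -/
noncomputable def cnotMat {n : ℕ} (c t : Fin n) : QMat n :=
  Matrix.of fun x y => if x = y + Pi.single t (y c) then 1 else 0

theorem bitSign_add (a b : ZMod 2) : bitSign (a + b) = bitSign a * bitSign b := by
  have h : ∀ a b : ZMod 2, ((-1 : ℤ)) ^ (a + b).val = (-1) ^ a.val * (-1) ^ b.val := by decide
  unfold bitSign
  exact_mod_cast congrArg (fun z : ℤ => (z : ℂ)) (h a b)

theorem bitSign_sq (a : ZMod 2) : bitSign a * bitSign a = 1 := by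
  rw [← bitSign_add, CharTwo.add_self_eq_zero]; simp [bitSign]

theorem star_bitSign (a : ZMod 2) : star (bitSign a) = bitSign a := by
  simp [bitSign]

theorem bits_eq_add_iff {n : ℕ} (x y a : Bits n) : x = y + a ↔ y = x + a := by
  constructor <;> rintro rfl <;> rw [add_assoc] <;> ext k <;>
    simp [CharTwo.add_self_eq_zero]

theorem bits_off_iff {n : ℕ} (j : Fin n) (x y : Bits n) :
    (∀ k, k ≠ j → x k = y k) ↔ (y = x ∨ y = x + Pi.single j 1) := by
  constructor
  · intro h
    by_cases hj : x j = y j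
    · left; ext k
      by_cases hk : k = j
      · subst hk; rw [hj]
      · rw [h k hk]
    · right; ext k
      by_cases hk : k = j
      · subst hk
        have : ∀ a b : ZMod 2, a ≠ b → b = a + 1 := by decide
        simpa only [Pi.add_apply, Pi.single_eq_same] using this _ _ hj
      · simp [hk, h k hk]
  · rintro (rfl | rfl) k hk <;> simp [hk]

theorem hadamardMat_star {n : ℕ} (j : Fin n) : star (hadamardMat j) = hadamardMat j := by
  ext x y
  have : (∀ k, k ≠ j → y k = x k) ↔ (∀ k, k ≠ j → x k = y k) := by
    constructor <;> intro h k hk <;> exact (h k hk).symm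
  simp only [Matrix.star_apply, hadamardMat, Matrix.of_apply, this]
  split_ifs
  · rw [star_mul', star_bitSign, mul_comm (y j)]; simp
  · simp

theorem hadamard_half :
    (((1 / Real.sqrt 2 : ℝ) : ℂ)) * (((1 / Real.sqrt 2 : ℝ) : ℂ)) = 1 / 2 := by
  rw [← Complex.ofReal_mul]
  have : (1 / Real.sqrt 2) * (1 / Real.sqrt 2) = 1 / 2 := by
    rw [div_mul_div_comm, Real.mul_self_sqrt (by norm_num)]; norm_num
  rw [this]; norm_num

theorem bits_add_single_ne {n : ℕ} (j : Fin n) (x : Bits n) : x ≠ x + Pi.single j 1 := by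
  intro h
  simpa using congrFun h j

theorem bits_add_single_add {n : ℕ} (j : Fin n) (x : Bits n) :
    x + Pi.single j 1 + Pi.single j 1 = x := by
  rw [add_assoc, ← Pi.single_add]
  have : (1 + 1 : ZMod 2) = 0 := by decide
  simp [this]

/-- A row of the Hadamard gate has two nonzero entries. -/
theorem hadamardMat_mul_apply {n : ℕ} (j : Fin n) (M : QMat n) (x y : Bits n) :
    (hadamardMat j * M) x y = ((1 / Real.sqrt 2 : ℝ) : ℂ) *
      (bitSign (x j) * M x y + M (x + Pi.single j 1) y) := by
  rw [Matrix.mul_apply,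
    ← Finset.sum_subset (Finset.subset_univ {x, x + Pi.single j 1})]
  · rw [Finset.sum_pair (bits_add_single_ne j x)]
    have h1 : ∀ k, k ≠ j → x k = (x + Pi.single j 1 : Bits n) k := by
      intro k hk; simp [hk]
    have hs : ∀ a : ZMod 2, a * a = a := by decide
    have ht : ∀ a : ZMod 2, a * (a + 1) = 0 := by decide
    rw [hadamardMat, Matrix.of_apply, Matrix.of_apply, if_pos h1, if_pos (fun _ _ => rfl), hs,
      Pi.add_apply, Pi.single_eq_same, ht]
    have h0 : bitSign 0 = 1 := by simp [bitSign]
    rw [h0]; ring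
  · intro z _ hz
    have : ¬ ∀ k, k ≠ j → x k = z k := by
      rw [bits_off_iff]; simpa using hz
    simp only [hadamardMat, Matrix.of_apply, if_neg this, zero_mul]

theorem hadamardMat_mul_self {n : ℕ} (j : Fin n) : hadamardMat j * hadamardMat j = 1 := by
  ext x y
  have key : ∀ M : QMat n, (hadamardMat j * (hadamardMat j * M)) x y = M x y := by
    intro M
    have e : bitSign (x j + 1) = - bitSign (x j) := by
      rw [bitSign_add]; simp [bitSign, ZMod.val_one]
    rw [hadamardMat_mul_apply, hadamardMat_mul_apply, hadamardMat_mul_apply,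
      bits_add_single_add, Pi.add_apply, Pi.single_eq_same, e]
    linear_combination (bitSign (x j) * bitSign (x j) * M x y + M x y) * hadamard_half
      + (1 / 2) * M x y * bitSign_sq (x j)
  simpa using key 1

theorem hadamardMat_mem {n : ℕ} (j : Fin n) :
    hadamardMat j ∈ Matrix.unitaryGroup (Bits n) ℂ := by
  rw [Matrix.mem_unitaryGroup_iff, hadamardMat_star, hadamardMat_mul_self]

theorem I_pow_star (k : ℕ) : Complex.I ^ k * star (Complex.I ^ k) = 1 := by
  simp [← mul_pow]

theorem phaseMat_mem {n : ℕ} (j : Fin n) :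
    phaseMat j ∈ Matrix.unitaryGroup (Bits n) ℂ := by
  rw [Matrix.mem_unitaryGroup_iff, phaseMat, Matrix.star_eq_conjTranspose,
    Matrix.diagonal_conjTranspose, Matrix.diagonal_mul_diagonal, ← Matrix.diagonal_one]
  congr 1
  ext x
  exact I_pow_star _

theorem cnot_invol {n : ℕ} {c t : Fin n} (h : c ≠ t) (x y : Bits n) :
    x = y + Pi.single t (y c) ↔ y = x + Pi.single t (x c) := by
  constructor <;> rintro rfl <;> simp [h, add_assoc, ← Pi.single_add, CharTwo.add_self_eq_zero]

theorem cnotMat_mul_apply {n : ℕ} {c t : Fin n} (h : c ≠ t) (M : QMat n) (x y : Bits n) :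
    (cnotMat c t * M) x y = M (x + Pi.single t (x c)) y := by
  simp only [Matrix.mul_apply, cnotMat, Matrix.of_apply, cnot_invol h x]
  simp

theorem cnotMat_mem {n : ℕ} {c t : Fin n} (h : c ≠ t) :
    cnotMat c t ∈ Matrix.unitaryGroup (Bits n) ℂ := by
  have hs : star (cnotMat c t) = cnotMat c t := by
    ext x y
    simp only [Matrix.star_apply, cnotMat, Matrix.of_apply, cnot_invol h y]
    split_ifs <;> simp
  rw [Matrix.mem_unitaryGroup_iff, hs]
  ext x y
  have : x + Pi.single t (x c) = y + Pi.single t (y c) ↔ x = y := by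
    rw [eq_comm, eq_comm (a := x)]
    constructor
    · intro e
      have := (cnot_invol h (x + Pi.single t (x c)) y).1 e.symm
      rw [this]
      simp [h, add_assoc, ← Pi.single_add, CharTwo.add_self_eq_zero]
    · rintro rfl; rfl
  rw [cnotMat_mul_apply h, cnotMat, Matrix.of_apply, Matrix.one_apply]
  simp only [this]

/-- The Clifford group on `n` qubits: generated by CNOT, Hadamard and phase gates. -/
def cliffordGroup (n : ℕ) : Subgroup (Matrix.unitaryGroup (Bits n) ℂ) :=
  Subgroup.closure
    {U | (∃ j, (U : QMat n) = hadamardMat j) ∨ (∃ j, (U : QMat n) = phaseMat j) ∨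
      ∃ c t, c ≠ t ∧ (U : QMat n) = cnotMat c t}

/-- The stabilizer states `C |b⟩` (`C` a Clifford circuit, `b` a bit string), each recorded
as its rank-one projector so that a global phase plays no role. -/
def stabilizerStates (n : ℕ) : Set (QMat n) :=
  {P | ∃ C ∈ cliffordGroup n, ∃ b : Bits n,
    P = Matrix.vecMulVec ((C : QMat n).mulVec (Pi.single b 1))
      (star ((C : QMat n).mulVec (Pi.single b 1)))}

theorem stabilizerState_eq {n : ℕ} (C : QMat n) (b : Bits n) :
    Matrix.vecMulVec (C.mulVec (Pi.single b 1)) (star (C.mulVec (Pi.single b 1)))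
      = C * Matrix.single b b 1 * star C := by
  rw [Matrix.single_eq_single_vecMulVec_single, Matrix.mul_vecMulVec, Matrix.vecMulVec_mul]
  congr 1
  rw [Matrix.star_mulVec, Matrix.star_eq_conjTranspose]
  congr 1
  ext k; by_cases hk : k = b <;> simp [hk]

/-- The Pauli matrix `ω X^a Z^b`. -/
noncomputable def pauliMat {n : ℕ} (ω : ℂ) (a b : Bits n) : QMat n :=
  Matrix.of fun x y => if x = y + a then ω * bitSign (b ⬝ᵥ y) else 0

/-- The Pauli group, with phases the fourth roots of unity. -/
def pauliSet (n : ℕ) : Set (QMat n) :=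
  {M | ∃ ω : ℂ, ω ^ 4 = 1 ∧ ∃ a b : Bits n, M = pauliMat ω a b}

theorem pauliSet_finite (n : ℕ) : (pauliSet n).Finite := by
  have h4 : {ω : ℂ | ω ^ 4 = 1}.Finite := by
    refine (Polynomial.nthRoots 4 (1 : ℂ)).toFinset.finite_toSet.subset ?_
    intro ω hω
    simpa [Polynomial.mem_nthRoots] using hω
  refine ((h4.prod (Set.finite_univ (α := Bits n × Bits n))).image
    (fun p => pauliMat p.1 p.2.1 p.2.2)).subset ?_
  rintro M ⟨ω, hω, a, b, rfl⟩
  exact ⟨(ω, a, b), ⟨hω, trivial⟩, rfl⟩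

theorem pauliMat_mul_apply {n : ℕ} (ω : ℂ) (a b : Bits n) (M : QMat n) (x y : Bits n) :
    (pauliMat ω a b * M) x y = ω * bitSign (b ⬝ᵥ (x + a)) * M (x + a) y := by
  simp only [Matrix.mul_apply, pauliMat, Matrix.of_apply, bits_eq_add_iff x]
  simp

theorem bitSign_pow_four (a : ZMod 2) : bitSign a ^ 4 = 1 := by
  linear_combination (bitSign a ^ 2 + 1) * bitSign_sq a

theorem hadamardMat_conj_pauli {n : ℕ} (j : Fin n) (M : QMat n) (hM : M ∈ pauliSet n) :
    ∃ M' ∈ pauliSet n, hadamardMat j * M = M' * hadamardMat j := by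
  obtain ⟨ω, hω, a, b, rfl⟩ := hM
  refine ⟨_, ⟨ω * bitSign (a j * b j), by rw [mul_pow, hω, bitSign_pow_four, one_mul],
    a + Pi.single j (a j + b j), b + Pi.single j (a j + b j), rfl⟩, ?_⟩
  ext x y
  rw [hadamardMat_mul_apply, pauliMat_mul_apply]
  have hoff : (∀ k, k ≠ j → (x + (a + Pi.single j (a j + b j)) : Bits n) k = y k) ↔
      (y = x + a ∨ y = x + a + Pi.single j 1) := by
    rw [← bits_off_iff]
    constructor <;> intro h k hk <;> simpa [hk] using h k hk
  have e1 : (x = y + a) ↔ y = x + a := bits_eq_add_iff x y a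
  have e2 : (x + Pi.single j 1 = y + a) ↔ y = x + a + Pi.single j 1 := by
    rw [bits_eq_add_iff, add_right_comm]
  have hne := bits_add_single_ne j (x + a)
  have hdot : (b + Pi.single j (a j + b j)) ⬝ᵥ (x + (a + Pi.single j (a j + b j))) =
      b ⬝ᵥ (x + a) + b j * (a j + b j) +
        (a j + b j) * (x j + a j + (a j + b j)) := by
    rw [← add_assoc, add_dotProduct, dotProduct_add b, single_dotProduct, dotProduct_single]
    simp
  simp only [hadamardMat, pauliMat, Matrix.of_apply, hoff, e1, e2, hdot]
  have k1 : ∀ x a b d : ZMod 2, x + d =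
      a * b + (d + b * (a + b) + (a + b) * (x + a + (a + b))) +
        (x + (a + (a + b))) * (x + a) := by decide
  have k2 : ∀ x a b d : ZMod 2, (d + b) =
      a * b + (d + b * (a + b) + (a + b) * (x + a + (a + b))) +
        (x + (a + (a + b))) * (x + a + 1) := by decide
  by_cases h1 : y = x + a
  · subst h1
    rw [if_pos rfl, if_neg hne, if_pos (Or.inl rfl)]
    have := congrArg bitSign (k1 (x j) (a j) (b j) (b ⬝ᵥ (x + a)))
    rw [bitSign_add (x j) (b ⬝ᵥ (x + a)), bitSign_add (_ + _) (_ * _),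
      bitSign_add (a j * b j)] at this
    simp only [Pi.add_apply, Pi.single_eq_same]
    linear_combination ((1 / Real.sqrt 2 : ℝ) : ℂ) * ω * this
  · by_cases h2 : y = x + a + Pi.single j 1
    · subst h2
      rw [if_neg h1, if_pos rfl, if_pos (Or.inr rfl)]
      have := congrArg bitSign (k2 (x j) (a j) (b j) (b ⬝ᵥ (x + a)))
      rw [bitSign_add (_ + _) (_ * _), bitSign_add (a j * b j)] at this
      simp only [dotProduct_add b (x + a), dotProduct_single, mul_one,
        Pi.add_apply, Pi.single_eq_same]
      linear_combination ((1 / Real.sqrt 2 : ℝ) : ℂ) * ω * this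
    · rw [if_neg h1, if_neg h2, if_neg (by tauto)]; simp

theorem phaseMat_conj_pauli {n : ℕ} (j : Fin n) (M : QMat n) (hM : M ∈ pauliSet n) :
    ∃ M' ∈ pauliSet n, phaseMat j * M = M' * phaseMat j := by
  obtain ⟨ω, hω, a, b, rfl⟩ := hM
  refine ⟨_, ⟨ω * Complex.I ^ (a j).val,
    by rw [mul_pow, hω, ← pow_mul, mul_comm (a j).val, pow_mul, Complex.I_pow_four]; simp,
    a, b + Pi.single j (a j), rfl⟩, ?_⟩
  ext x y
  rw [phaseMat, Matrix.diagonal_mul, Matrix.mul_diagonal]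
  simp only [pauliMat, Matrix.of_apply]
  by_cases h : x = y + a
  · rw [if_pos h, if_pos h, h, add_dotProduct, single_dotProduct, bitSign_add]
    have key : ∀ p q : ZMod 2, Complex.I ^ (p + q).val =
        Complex.I ^ q.val * bitSign (q * p) * Complex.I ^ p.val := by
      intro p q
      have hc : ∀ p : ZMod 2, p = 0 ∨ p = 1 := by decide
      have h2 : (1 + 1 : ZMod 2) = 0 := by decide
      rcases hc p with rfl | rfl <;> rcases hc q with rfl | rfl <;>
        simp [bitSign, ZMod.val_one, h2]
    rw [Pi.add_apply, key]; ring
  · rw [if_neg h, if_neg h]; simp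

theorem cnotMat_conj_pauli {n : ℕ} {c t : Fin n} (hct : c ≠ t) (M : QMat n)
    (hM : M ∈ pauliSet n) : ∃ M' ∈ pauliSet n, cnotMat c t * M = M' * cnotMat c t := by
  obtain ⟨ω, hω, a, b, rfl⟩ := hM
  refine ⟨_, ⟨ω, hω, a + Pi.single t (a c), b + Pi.single c (b t), rfl⟩, ?_⟩
  ext x y
  rw [cnotMat_mul_apply hct, pauliMat_mul_apply]
  have e : (x + Pi.single t (x c) = y + a) ↔
      (x + (a + Pi.single t (a c)) = y + Pi.single t (y c)) := by
    constructor
    · intro h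
      have hc : y c = x c + a c := by
        have := congrFun h c
        simp [hct] at this
        rw [this, add_assoc, CharTwo.add_self_eq_zero, add_zero]
      have hy : y = x + Pi.single t (x c) + a := (bits_eq_add_iff _ _ _).1 h
      rw [hc, hy, Pi.single_add]
      have : (Pi.single t (x c) + Pi.single t (x c) : Bits n) = 0 := by
        rw [← Pi.single_add, CharTwo.add_self_eq_zero, Pi.single_zero]
      linear_combination -this
    · intro h
      have hc : x c + a c = y c := by simpa [hct] using congrFun h c
      rw [← hc, Pi.single_add] at h
      have h' : x + a = y + Pi.single t (x c) := by linear_combination h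
      have : (Pi.single t (x c) + Pi.single t (x c) : Bits n) = 0 := by
        rw [← Pi.single_add, CharTwo.add_self_eq_zero, Pi.single_zero]
      have h2 : y = x + a + Pi.single t (x c) := (bits_eq_add_iff _ _ _).1 h'
      have h3 : (a + a : Bits n) = 0 := by ext k; exact CharTwo.add_self_eq_zero _
      rw [h2]; linear_combination -h3
  simp only [pauliMat, cnotMat, Matrix.of_apply, e]
  split_ifs with h
  · rw [mul_one, h]
    congr 2
    simp only [add_dotProduct, dotProduct_add, single_dotProduct, dotProduct_single]
    have := CharTwo.add_self_eq_zero (b t * y c)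
    simp [hct]
    linear_combination -this
  · simp

theorem conj_pauli_of_comm {n : ℕ} {U : QMat n} (hU : U ∈ Matrix.unitaryGroup (Bits n) ℂ)
    (h : ∀ M ∈ pauliSet n, ∃ M' ∈ pauliSet n, U * M = M' * U) :
    ∀ M ∈ pauliSet n, U * M * star U ∈ pauliSet n := by
  intro M hM
  obtain ⟨M', hM', e⟩ := h M hM
  rwa [e, mul_assoc, Matrix.mem_unitaryGroup_iff.1 hU, mul_one]

/-- Clifford circuits map Pauli matrices to Pauli matrices under conjugation. -/
theorem clifford_conj_pauli {n : ℕ} (C : Matrix.unitaryGroup (Bits n) ℂ)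
    (hC : C ∈ cliffordGroup n) :
    ∀ M ∈ pauliSet n, (C : QMat n) * M * star (C : QMat n) ∈ pauliSet n := by
  induction hC using Subgroup.closure_induction with
  | mem U hU =>
    apply conj_pauli_of_comm U.2
    rcases hU with ⟨j, h⟩ | ⟨j, h⟩ | ⟨c, t, hct, h⟩ <;> rw [h]
    · exact hadamardMat_conj_pauli j
    · exact phaseMat_conj_pauli j
    · exact cnotMat_conj_pauli hct
  | one => simp
  | mul U V _ _ hU hV =>
    intro M hM
    have := hU _ (hV M hM)
    simpa [mul_assoc] using this
  | inv U _ hU =>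
    have hl : star (U : QMat n) * (U : QMat n) = 1 := Matrix.mem_unitaryGroup_iff'.1 U.2
    have hr : (U : QMat n) * star (U : QMat n) = 1 := Matrix.mem_unitaryGroup_iff.1 U.2
    have hinj : Set.InjOn (fun M : QMat n => (U : QMat n) * M * star (U : QMat n))
        (pauliSet n) := by
      intro M _ N _ h
      have h2 := congrArg (fun T => star (U : QMat n) * T * (U : QMat n)) h
      simpa [mul_assoc, hl, ← mul_assoc (star (U : QMat n)) (U : QMat n)] using h2
    intro M hM
    have himg : (fun M : QMat n => (U : QMat n) * M * star (U : QMat n)) '' pauliSet n =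
        pauliSet n :=
      Set.eq_of_subset_of_ncard_le (Set.image_subset_iff.2 hU)
        (Set.InjOn.ncard_image hinj).ge (pauliSet_finite n)
    obtain ⟨N, hN, e⟩ : M ∈ (fun M : QMat n => (U : QMat n) * M * star (U : QMat n)) ''
        pauliSet n := by rw [himg]; exact hM
    change (U : QMat n) * N * star (U : QMat n) = M at e
    have : star (U : QMat n) * M * (U : QMat n) = N := by
      rw [← e]
      simp [mul_assoc, hl, ← mul_assoc (star (U : QMat n)) (U : QMat n)]
    simpa [this] using hN

theorem sum_bitSign {n : ℕ} (z : Bits n) :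
    ∑ a : Bits n, bitSign (a ⬝ᵥ z) = if z = 0 then 2 ^ n else 0 := by
  split_ifs with h
  · subst h; simp [bitSign]
  · obtain ⟨k, hk⟩ := Function.ne_iff.1 h
    have hk : z k = 1 := by
      have : ∀ p : ZMod 2, p ≠ 0 → p = 1 := by decide
      exact this _ hk
    have h1 : ∑ a : Bits n, bitSign (a ⬝ᵥ z) = ∑ a : Bits n, bitSign ((a + Pi.single k 1) ⬝ᵥ z) :=
      (Equiv.sum_comp (Equiv.addRight (Pi.single k 1 : Bits n)) _).symm
    have h2 : ∀ a : Bits n, bitSign ((a + Pi.single k 1) ⬝ᵥ z) = - bitSign (a ⬝ᵥ z) := by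
      intro a
      rw [add_dotProduct, single_dotProduct, hk, bitSign_add]
      simp [bitSign, ZMod.val_one]
    simp only [h2, Finset.sum_neg_distrib] at h1
    linear_combination h1 / 2

theorem stabilizerStates_finite (n : ℕ) : (stabilizerStates n).Finite := by
  have : Finite (pauliSet n) := pauliSet_finite n
  refine (Set.finite_range (fun q : Bits n → pauliSet n =>
    (1 / 2 ^ n : ℂ) • ∑ a, (q a : QMat n))).subset ?_
  rintro P ⟨C, hC, b, rfl⟩
  have hq : ∀ a : Bits n, pauliMat (bitSign (a ⬝ᵥ b)) 0 a ∈ pauliSet n :=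
    fun a => ⟨_, bitSign_pow_four _, _, _, rfl⟩
  have hb : (Matrix.single b b 1 : QMat n) =
      (1 / 2 ^ n : ℂ) • ∑ a : Bits n, pauliMat (bitSign (a ⬝ᵥ b)) 0 a := by
    ext x y
    rw [Matrix.smul_apply, Matrix.sum_apply]
    simp only [pauliMat, Matrix.of_apply, add_zero]
    by_cases hxy : x = y
    · subst hxy
      simp only [if_true, ← bitSign_add, ← dotProduct_add, sum_bitSign]
      have : b + x = 0 ↔ b = x := by
        have h3 : (x + x : Bits n) = 0 := by ext k; exact CharTwo.add_self_eq_zero _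
        rw [← h3, add_left_inj]
      simp only [this, Matrix.single_apply]
      split_ifs <;> simp_all
    · simp only [if_neg hxy, Finset.sum_const_zero, smul_zero]
      rw [Matrix.single_apply, if_neg]
      rintro ⟨rfl, rfl⟩; exact hxy rfl
  refine ⟨fun a => ⟨_, clifford_conj_pauli C hC _ (hq a)⟩, ?_⟩
  rw [stabilizerState_eq, hb]
  simp [Finset.mul_sum, Finset.sum_mul]

/-- The set of outcomes of the stabilizer measurement. -/
def StabState (n : ℕ) : Type := stabilizerStates n

/-- The projector `|s⟩⟨s|` of a stabilizer state. -/
def StabState.proj {n : ℕ} (s : StabState n) : QMat n := s.1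

noncomputable instance (n : ℕ) : Fintype (StabState n) := (stabilizerStates_finite n).fintype

instance (n : ℕ) : MeasurableSpace (StabState n) := ⊤

instance (n : ℕ) : MeasurableSingletonClass (StabState n) := ⟨fun _ => trivial⟩

instance (n : ℕ) : Nonempty (StabState n) := ⟨⟨_, 1, one_mem _, 0, rfl⟩⟩

/-- An `n`-qubit state: a density matrix. -/
structure QState (n : ℕ) where
  mat : QMat n
  posSemidef : mat.PosSemidef
  trace_eq_one : mat.trace = 1

/-- The POVM element `(2 ^ n / |STAB|) |s⟩⟨s|` of the stabilizer measurement. -/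
noncomputable def stabEffect {n : ℕ} (s : StabState n) : QMat n :=
  ((2 : ℂ) ^ n / Fintype.card (StabState n)) • s.proj

theorem clifford_conj_stab {n : ℕ} {U : Matrix.unitaryGroup (Bits n) ℂ}
    (hU : U ∈ cliffordGroup n) (s : StabState n) :
    (U : QMat n) * s.proj * star (U : QMat n) ∈ stabilizerStates n := by
  obtain ⟨P, C, hC, b, rfl⟩ := s
  refine ⟨U * C, mul_mem hU hC, b, ?_⟩
  simp only [StabState.proj, stabilizerState_eq]
  simp [mul_assoc]

theorem clifford_comm_sum {n : ℕ} {U : Matrix.unitaryGroup (Bits n) ℂ}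
    (hU : U ∈ cliffordGroup n) :
    (U : QMat n) * (∑ s : StabState n, s.proj) = (∑ s : StabState n, s.proj) * (U : QMat n) := by
  have hl : star (U : QMat n) * (U : QMat n) = 1 := Matrix.mem_unitaryGroup_iff'.1 U.2
  let f : StabState n → StabState n := fun s => ⟨_, clifford_conj_stab hU s⟩
  have hf : Function.Injective f := by
    intro s t h
    have h1 : (U : QMat n) * s.proj * star (U : QMat n) =
        (U : QMat n) * t.proj * star (U : QMat n) := congrArg Subtype.val h
    have h2 := congrArg (fun T => star (U : QMat n) * T * (U : QMat n)) h1
    have h3 : s.proj = t.proj := by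
      simpa [mul_assoc, hl, ← mul_assoc (star (U : QMat n)) (U : QMat n)] using h2
    exact Subtype.ext h3
  have hs : ∑ s : StabState n, (f s).proj = ∑ s : StabState n, s.proj :=
    Function.Bijective.sum_comp (Finite.injective_iff_bijective.1 hf) StabState.proj
  have hs' : (U : QMat n) * (∑ s : StabState n, s.proj) * star (U : QMat n) =
      ∑ s : StabState n, s.proj := by
    rw [Finset.mul_sum, Finset.sum_mul]; exact hs
  calc _ = (U : QMat n) * (∑ s : StabState n, s.proj) * (star (U : QMat n) * (U : QMat n)) := by
        rw [hl, mul_one]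
    _ = _ := by rw [← mul_assoc, hs']

theorem stab_trace {n : ℕ} (s : StabState n) : s.proj.trace = 1 := by
  obtain ⟨P, C, hC, b, rfl⟩ := s
  simp only [StabState.proj, stabilizerState_eq]
  rw [Matrix.trace_mul_comm, ← mul_assoc, Matrix.mem_unitaryGroup_iff'.1 C.2, one_mul,
    Matrix.trace_single_eq_same]

theorem scalar_of_comm {n : ℕ} (T : QMat n)
    (hP : ∀ j, phaseMat j * T = T * phaseMat j)
    (hH : ∀ j, hadamardMat j * T = T * hadamardMat j) (x y : Bits n) :
    T x y = if x = y then T 0 0 else 0 := by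
  have hoff : ∀ x y, x ≠ y → T x y = 0 := by
    intro x y hxy
    obtain ⟨j, hj⟩ := Function.ne_iff.1 hxy
    have h := congrFun (congrFun (hP j) x) y
    rw [phaseMat, Matrix.diagonal_mul, Matrix.mul_diagonal] at h
    have hI : ∀ p q : ZMod 2, p ≠ q → Complex.I ^ p.val - Complex.I ^ q.val ≠ 0 := by
      intro p q hpq
      have hc : ∀ p : ZMod 2, p = 0 ∨ p = 1 := by decide
      rcases hc p with rfl | rfl <;> rcases hc q with rfl | rfl <;>
        simp [ZMod.val_one, Complex.ext_iff] at hpq ⊢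
    have h2 : (Complex.I ^ (x j).val - Complex.I ^ (y j).val) * T x y = 0 := by
      linear_combination h
    exact (mul_eq_zero.1 h2).resolve_left (hI _ _ hj)
  have hstep : ∀ (j : Fin n) (x : Bits n), T (x + Pi.single j 1) (x + Pi.single j 1) = T x x := by
    intro j x
    have h := congrFun (congrFun (hH j) x) (x + Pi.single j 1)
    rw [hadamardMat_mul_apply, hoff _ _ (bits_add_single_ne j x), Matrix.mul_apply,
      Finset.sum_eq_single x (fun z _ hz => by rw [hoff x z hz.symm, zero_mul]) (by simp)] at h
    have hH' : hadamardMat j x (x + Pi.single j 1) = ((1 / Real.sqrt 2 : ℝ) : ℂ) := by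
      have hx := hadamardMat_mul_apply j (1 : QMat n) x (x + Pi.single j 1)
      rw [mul_one, Matrix.one_apply_ne (bits_add_single_ne j x), Matrix.one_apply_eq] at hx
      simpa using hx
    rw [hH'] at h
    have hr : ((1 / Real.sqrt 2 : ℝ) : ℂ) ≠ 0 := by
      intro h0
      have := hadamard_half
      rw [h0] at this
      norm_num at this
    apply mul_left_cancel₀ hr
    linear_combination h
  have hdiag : ∀ S : Finset (Fin n), ∀ x : Bits n, (∀ k, k ∉ S → x k = 0) → T x x = T 0 0 := by
    intro S
    induction S using Finset.induction_on with
    | empty =>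
      intro x hx
      have : x = 0 := by ext k; simpa using congrArg ZMod.val (hx k (by simp))
      rw [this]
    | insert j S hj ih =>
      intro x hx
      by_cases h0 : x j = 0
      · apply ih
        intro k hk
        by_cases hkj : k = j
        · rw [hkj, h0]
        · exact hx k (by simp [hk, hkj])
      · rw [← hstep j x]
        apply ih
        intro k hk
        by_cases hkj : k = j
        · subst hkj
          have : ∀ p : ZMod 2, p ≠ 0 → p + 1 = 0 := by decide
          simpa only [Pi.add_apply, Pi.single_eq_same] using this _ h0
        · simp [hkj, hx k (by simp [hk, hkj])]
  split_ifs with h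
  · subst h; exact hdiag Finset.univ x (by simp)
  · exact hoff x y h

/-- The stabilizer measurement is a POVM: its elements sum to the identity. -/
theorem stabEffect_sum (n : ℕ) : ∑ s : StabState n, stabEffect s = 1 := by
  have hP : ∀ j : Fin n, phaseMat j * (∑ s : StabState n, s.proj) =
      (∑ s : StabState n, s.proj) * phaseMat j := fun j =>
    clifford_comm_sum (U := ⟨_, phaseMat_mem j⟩)
      (Subgroup.subset_closure (Or.inr (Or.inl ⟨j, rfl⟩)))
  have hH : ∀ j : Fin n, hadamardMat j * (∑ s : StabState n, s.proj) =
      (∑ s : StabState n, s.proj) * hadamardMat j := fun j =>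
    clifford_comm_sum (U := ⟨_, hadamardMat_mem j⟩)
      (Subgroup.subset_closure (Or.inl ⟨j, rfl⟩))
  have hT := scalar_of_comm _ hP hH
  have htr : (∑ s : StabState n, s.proj).trace = Fintype.card (StabState n) := by
    rw [Matrix.trace_sum]; simp [stab_trace]
  have hc : (Fintype.card (StabState n) : ℂ) ≠ 0 := by
    exact_mod_cast Fintype.card_ne_zero
  have h0 : (2 : ℂ) ^ n * (∑ s : StabState n, s.proj) 0 0 = Fintype.card (StabState n) := by
    rw [← htr, Matrix.trace]
    have : ∀ x : Bits n, (∑ s : StabState n, s.proj) x x = (∑ s : StabState n, s.proj) 0 0 :=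
      fun x => by rw [hT x x, if_pos rfl]
    simp only [Matrix.diag_apply, this]
    simp
  have : ∑ s : StabState n, stabEffect s =
      ((2 : ℂ) ^ n / Fintype.card (StabState n)) • ∑ s : StabState n, s.proj := by
    rw [Finset.smul_sum]; rfl
  rw [this]
  ext x y
  rw [Matrix.smul_apply, hT x y, Matrix.one_apply]
  split_ifs
  · rw [smul_eq_mul, div_mul_eq_mul_div, h0, div_self hc]
  · simp

theorem stabEffect_nonneg {n : ℕ} (ρ : QState n) (s : StabState n) :
    0 ≤ (Matrix.trace (stabEffect s * ρ.mat)).re := by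
  obtain ⟨C, hC, b, hs⟩ := s.2
  have h := ρ.posSemidef.dotProduct_mulVec_nonneg ((C : QMat n).mulVec (Pi.single b 1))
  rw [stabEffect, Matrix.smul_mul, Matrix.trace_smul]
  rw [show s.proj = _ from hs, Matrix.vecMulVec_mul, Matrix.trace_vecMulVec, dotProduct_comm, ← Matrix.dotProduct_mulVec]
  have e : ((2 : ℂ) ^ n / Fintype.card (StabState n)) =
      (((2 : ℝ) ^ n / Fintype.card (StabState n) : ℝ) : ℂ) := by push_cast; rfl
  rw [e, smul_eq_mul, Complex.re_ofReal_mul]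
  exact mul_nonneg (by positivity) (Complex.le_def.1 h).1

/-- The outcome distribution of the stabilizer measurement on the state `ρ` (Born's rule). -/
noncomputable def stabPMF {n : ℕ} (ρ : QState n) : PMF (StabState n) :=
  PMF.ofFintype (fun s => ENNReal.ofReal (Matrix.trace (stabEffect s * ρ.mat)).re) (by
    rw [← ENNReal.ofReal_sum_of_nonneg (fun s _ => stabEffect_nonneg ρ s), ← Complex.re_sum,
      ← Matrix.trace_sum, ← Finset.sum_mul, stabEffect_sum, one_mul, ρ.trace_eq_one]
    simp)

/-- The joint law of the outcomes of independent stabilizer measurements on `N` copies of `ρ`. -/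
noncomputable def stabLaw {n : ℕ} (ρ : QState n) (N : ℕ) : Measure (Fin N → StabState n) :=
  Measure.pi fun _ => (stabPMF ρ).toMeasure

/-- `max_i tr(O_i ^ 2)`. -/
noncomputable def maxTrSq {n M : ℕ} (O : Fin M → QMat n) : ℝ :=
  ⨆ i, (Matrix.trace (O i * O i)).re

/-! There are two protocols, and the three terms of the minimum come from three ways of using them.
Write `D = 2 ^ n`.

Classical shadows give the first term. Stabilizer states form a 3-design (`stab_two_design`,
`stab_three_design`), so for the traceless part `A` of `O` the quantity `(D + 1) * tr (s A)` has
mean `tr (ρ A)` and second moment at most `3 * tr (O ^ 2)`, whatever `D` and `ρ` are.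
Median-of-means turns bounded variance into exponentially small failure probability, and a union
bound over the observables costs only `log M` (`exists_predict_family`).

Tomography gives the other two. The shadow protocol is applied to the rank-one projectors of a net
of `25 ^ D` unit vectors, whose logarithm is of order `D`. Any state `σ` compatible with all these
predictions to accuracy `τ` differs from `ρ` by at most `4τ` in operator norm. Since a difference of
states has trace norm at most 2, its squared Frobenius norm is at most `min (8τ) (16 D τ ^ 2)`
(`exists_tomography`). Cauchy-Schwarz then predicts every observable at once, independently of `M`,
and each branch of this minimum yields one of the remaining terms. The factors `log⁺` are not needed
for accuracy: they are bounded below once `B > 2 ε ^ 2`, and for smaller `B` a constant answer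
suffices, so that no copies are used.

The 3-design property is proved by symmetry. Up to phase, Pauli matrices are labelled by vectors
over `ZMod 2` with a symplectic form recording commutation. The Clifford gates generate all
symplectic transvections (`exists_clifford_transvection`) and all Pauli matrices
(`exists_clifford_pauli`). Pauli invariance kills every triple correlation whose labels do not add
up to zero. Transvection invariance makes the surviving ones depend only on whether the labels
coincide, vanish or commute, and Parseval's identity then fixes their values (`pauliCorr_eq`). -/

/-! ### Hermitian Pauli matrices and the symplectic form on their labels -/

/-- The Hermitian Pauli matrix with label `u = (a, b)`, proportional to `X^a Z^b`. -/
noncomputable def hermPauli {n : ℕ} (u : Bits n × Bits n) : QMat n :=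
  pauliMat (Complex.I ^ (u.1 ⬝ᵥ u.2).val) u.1 u.2

/-- The symplectic form on Pauli labels. -/
def sympForm {n : ℕ} (u v : Bits n × Bits n) : ZMod 2 := u.1 ⬝ᵥ v.2 + u.2 ⬝ᵥ v.1

theorem sympForm_comm {n : ℕ} (u v : Bits n × Bits n) : sympForm u v = sympForm v u := by
  rw [sympForm, sympForm, dotProduct_comm, dotProduct_comm u.2, add_comm]

theorem sympForm_add_left {n : ℕ} (u v w : Bits n × Bits n) :
    sympForm (u + v) w = sympForm u w + sympForm v w := by
  simp only [sympForm, Prod.fst_add, Prod.snd_add, add_dotProduct]; ring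

theorem sympForm_add_right {n : ℕ} (u v w : Bits n × Bits n) :
    sympForm u (v + w) = sympForm u v + sympForm u w := by
  rw [sympForm_comm, sympForm_add_left, sympForm_comm v, sympForm_comm w]

theorem sympForm_self {n : ℕ} (u : Bits n × Bits n) : sympForm u u = 0 := by
  rw [sympForm, dotProduct_comm u.2, CharTwo.add_self_eq_zero]

theorem sympForm_zero_left {n : ℕ} (u : Bits n × Bits n) : sympForm 0 u = 0 := by
  simp [sympForm]

theorem zmod_two_cases (a : ZMod 2) : a = 0 ∨ a = 1 := by
  revert a; decide

theorem label_add_self {n : ℕ} (u : Bits n × Bits n) : u + u = 0 := by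
  ext k <;> exact CharTwo.add_self_eq_zero _

theorem bitSign_zero : bitSign 0 = 1 := by simp [bitSign]

theorem bitSign_one : bitSign 1 = -1 := by simp [bitSign, ZMod.val_one]

theorem pauliMat_mul {n : ℕ} (ω ω' : ℂ) (a b a' b' : Bits n) :
    pauliMat ω a b * pauliMat ω' a' b' =
      pauliMat (ω * ω' * bitSign (b ⬝ᵥ a')) (a + a') (b + b') := by
  ext x y
  rw [pauliMat_mul_apply]
  simp only [pauliMat, Matrix.of_apply]
  have e : x + a = y + a' ↔ x = y + (a + a') := by
    rw [← bits_eq_add_iff, bits_eq_add_iff y, eq_comm, add_comm a a', ← add_assoc,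
      bits_eq_add_iff]
  simp only [e]
  split_ifs with h
  · rw [e.2 h, dotProduct_add, bitSign_add, add_dotProduct, bitSign_add]; ring
  · simp

theorem pauliMat_smul {n : ℕ} (c ω : ℂ) (a b : Bits n) :
    c • pauliMat ω a b = pauliMat (c * ω) a b := by
  ext x y
  simp only [pauliMat, Matrix.smul_apply, Matrix.of_apply, smul_eq_mul]
  split_ifs <;> ring

theorem I_pow_val_sq (z : ZMod 2) : Complex.I ^ z.val * Complex.I ^ z.val = bitSign z := by
  rcases zmod_two_cases z with rfl | rfl <;> simp [bitSign, ZMod.val_one]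

theorem I_pow_val_ne_zero (z : ZMod 2) : Complex.I ^ z.val ≠ 0 :=
  pow_ne_zero _ Complex.I_ne_zero

theorem hermPauli_zero (n : ℕ) : hermPauli (0 : Bits n × Bits n) = 1 := by
  ext x y
  simp [hermPauli, pauliMat, Matrix.one_apply, bitSign]

theorem hermPauli_star {n : ℕ} (u : Bits n × Bits n) : star (hermPauli u) = hermPauli u := by
  ext x y
  have e : y = x + u.1 ↔ x = y + u.1 := (bits_eq_add_iff _ _ _)
  simp only [Matrix.star_apply, hermPauli, pauliMat, Matrix.of_apply, e]
  split_ifs with h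
  · rw [star_mul', star_bitSign, h, dotProduct_add, bitSign_add, dotProduct_comm u.2 u.1]
    have h1 := I_pow_star (u.1 ⬝ᵥ u.2).val
    have h2 := I_pow_val_sq (u.1 ⬝ᵥ u.2)
    apply mul_left_cancel₀ (I_pow_val_ne_zero (u.1 ⬝ᵥ u.2))
    linear_combination (bitSign (u.2 ⬝ᵥ y) * bitSign (u.1 ⬝ᵥ u.2)) * h1 -
      (bitSign (u.2 ⬝ᵥ y)) * h2
  · simp

theorem hermPauli_comm {n : ℕ} (u v : Bits n × Bits n) :
    hermPauli u * hermPauli v = bitSign (sympForm u v) • (hermPauli v * hermPauli u) := by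
  simp only [hermPauli, pauliMat_mul, pauliMat_smul, sympForm, bitSign_add]
  rw [add_comm v.1, add_comm v.2, dotProduct_comm v.2 u.1]
  congr 1
  linear_combination -(Complex.I ^ (u.1 ⬝ᵥ u.2).val * Complex.I ^ (v.1 ⬝ᵥ v.2).val *
    bitSign (u.2 ⬝ᵥ v.1)) * bitSign_sq (u.1 ⬝ᵥ v.2)

theorem pauliMat_ne_zero {n : ℕ} {ω : ℂ} (hω : ω ≠ 0) (a b : Bits n) : pauliMat ω a b ≠ 0 := by
  intro h
  have := congrFun (congrFun h a) 0
  simp [pauliMat, bitSign, hω] at this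

theorem hermPauli_sq {n : ℕ} (u : Bits n × Bits n) : hermPauli u * hermPauli u = 1 := by
  rw [hermPauli, pauliMat_mul, I_pow_val_sq, dotProduct_comm u.2, bitSign_sq,
    ← hermPauli_zero, hermPauli]
  have h1 : u.1 + u.1 = 0 := congrArg Prod.fst (label_add_self u)
  have h2 : u.2 + u.2 = 0 := congrArg Prod.snd (label_add_self u)
  rw [h1, h2]; simp

/-- The adjoint of a product of Hermitian matrices is the reversed product, so commutation decides
the phase: `z` is real for commuting labels and imaginary for anticommuting ones. -/
theorem hermPauli_mul {n : ℕ} (u v : Bits n × Bits n) : ∃ z : ℂ, z * star z = 1 ∧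
    star z = bitSign (sympForm u v) * z ∧ hermPauli u * hermPauli v = z • hermPauli (u + v) := by
  have e : ∃ z : ℂ, z * star z = 1 ∧ hermPauli u * hermPauli v = z • hermPauli (u + v) := by
    refine ⟨Complex.I ^ (u.1 ⬝ᵥ u.2).val * Complex.I ^ (v.1 ⬝ᵥ v.2).val * bitSign (u.2 ⬝ᵥ v.1) *
      star (Complex.I ^ ((u + v).1 ⬝ᵥ (u + v).2).val), ?_, ?_⟩
    · simp only [star_mul', star_bitSign, star_star]
      have h1 := I_pow_star (u.1 ⬝ᵥ u.2).val
      have h2 := I_pow_star (v.1 ⬝ᵥ v.2).val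
      have h3 := I_pow_star ((u + v).1 ⬝ᵥ (u + v).2).val
      have h4 := bitSign_sq (u.2 ⬝ᵥ v.1)
      generalize Complex.I ^ (u.1 ⬝ᵥ u.2).val = p at *
      generalize Complex.I ^ (v.1 ⬝ᵥ v.2).val = q at *
      generalize Complex.I ^ ((u + v).1 ⬝ᵥ (u + v).2).val = r at *
      calc _ = (p * star p) * (q * star q) * (r * star r) *
          (bitSign (u.2 ⬝ᵥ v.1) * bitSign (u.2 ⬝ᵥ v.1)) := by ring
        _ = 1 := by rw [h1, h2, h3, h4]; ring
    · simp only [hermPauli, pauliMat_mul, pauliMat_smul]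
      rw [mul_assoc _ (star _), mul_comm (star _), I_pow_star, mul_one]; rfl
  obtain ⟨z, hz, h⟩ := e
  refine ⟨z, hz, ?_, h⟩
  have hs := congrArg star h
  rw [star_mul, hermPauli_star, hermPauli_star, star_smul, hermPauli_star, hermPauli_comm v u, h,
    smul_smul, sympForm_comm v u] at hs
  have h0 : hermPauli (u + v) ≠ 0 := pauliMat_ne_zero (I_pow_val_ne_zero _) _ _
  exact (smul_left_injective ℂ h0 hs).symm

theorem hermPauli_mul_of_sympForm_one {n : ℕ} {u v : Bits n × Bits n} (h : sympForm u v = 1) :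
    ∃ κ : ℂ, κ * κ = 1 ∧ hermPauli u * hermPauli v = (κ * Complex.I) • hermPauli (u + v) := by
  obtain ⟨z, h1, h2, h3⟩ := hermPauli_mul u v
  rw [h, bitSign_one] at h2
  rw [h2] at h1
  refine ⟨-Complex.I * z, ?_, ?_⟩
  · linear_combination (z * z) * Complex.I_mul_I + h1
  · rw [h3]; congr 1; linear_combination z * Complex.I_mul_I

/-- Expansion of a matrix in the Pauli basis. -/
theorem sum_trace_smul_hermPauli {n : ℕ} (M : QMat n) :
    ∑ u, Matrix.trace (M * hermPauli u) • hermPauli u = (2 ^ n : ℂ) • M := by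
  ext x y
  rw [Matrix.sum_apply, Fintype.sum_prod_type]
  have hx : ∀ a b : Bits n, (Matrix.trace (M * hermPauli (a, b)) • hermPauli (a, b)) x y =
      if a = x + y then ∑ k, M k (k + a) * bitSign (b ⬝ᵥ (a + y + k)) else 0 := by
    intro a b
    have e : x = y + a ↔ a = x + y := by
      rw [add_comm y, bits_eq_add_iff]
    simp only [hermPauli, Matrix.trace, Matrix.diag_apply, Matrix.mul_apply, Matrix.smul_apply,
      pauliMat, Matrix.of_apply, e, smul_eq_mul]
    split_ifs with h
    · rw [Finset.sum_mul]
      refine Finset.sum_congr rfl fun k _ => ?_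
      simp only [mul_ite, mul_zero, Finset.sum_ite_eq', Finset.mem_univ, if_true]
      rw [dotProduct_add, dotProduct_add, bitSign_add, bitSign_add, dotProduct_comm b a]
      linear_combination (M k (k + a) * bitSign (b ⬝ᵥ k) * bitSign (b ⬝ᵥ y)) *
        I_pow_val_sq (a ⬝ᵥ b)
    · rw [mul_zero]
  simp only [hx]
  rw [Finset.sum_comm]
  simp only [Finset.sum_ite_eq', Finset.mem_univ, if_true]
  rw [Finset.sum_comm]
  simp only [← Finset.mul_sum, sum_bitSign]
  have hz : ∀ k, x + y + y + k = 0 ↔ k = x := by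
    intro k
    have h1 : y + y = 0 := by ext k; exact CharTwo.add_self_eq_zero _
    have h2 : k + k = 0 := by ext k; exact CharTwo.add_self_eq_zero _
    rw [add_assoc x, h1, add_zero, ← h2, add_left_inj, eq_comm]
  have h1 : x + (x + y) = y := by
    rw [← add_assoc, show x + x = 0 from by ext k; exact CharTwo.add_self_eq_zero _, zero_add]
  simp only [hz, mul_ite, mul_zero, Finset.sum_ite_eq', Finset.mem_univ, if_true, h1,
    Matrix.smul_apply, smul_eq_mul]
  ring

/-! ### Symplectic geometry: separation of labels and transvections -/

theorem sum_bitSign_sympForm {n : ℕ} {p : Bits n × Bits n} (hp : p ≠ 0) :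
    ∑ q, bitSign (sympForm p q) = 0 := by
  rw [Fintype.sum_prod_type]
  simp only [sympForm, bitSign_add, dotProduct_comm p.1, dotProduct_comm p.2]
  simp only [← Finset.sum_mul, ← Finset.mul_sum, sum_bitSign]
  by_cases h : p.1 = 0
  · have : p.2 ≠ 0 := fun h2 => hp (Prod.ext h h2)
    simp [this]
  · simp [h]

/-- Nondegeneracy of the form: if `p` were orthogonal to everything, the character sum would count
all labels instead of vanishing. -/
theorem exists_sympForm_eq_one {n : ℕ} {p : Bits n × Bits n} (hp : p ≠ 0) :
    ∃ z, sympForm p z = 1 := by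
  by_contra! h
  have h1 := sum_bitSign_sympForm hp
  have h2 : ∀ q, sympForm p q = 0 := fun q => (zmod_two_cases _).resolve_right (h q)
  simp [h2, bitSign_zero] at h1

/-- A label outside the span of `p` can be separated from `p` by the symplectic form. -/
theorem exists_sympForm_separating {n : ℕ} {p q : Bits n × Bits n} (hq : q ≠ 0) (hpq : q ≠ p) :
    ∃ z, sympForm p z = 0 ∧ sympForm q z = 1 := by
  obtain ⟨y, hy⟩ := exists_sympForm_eq_one hq
  have hs : p + q ≠ 0 := by
    intro h
    apply hpq
    rw [← label_add_self q, add_left_inj] at h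
    exact h.symm
  obtain ⟨y', hy'⟩ := exists_sympForm_eq_one hs
  rw [sympForm_add_left] at hy'
  rcases zmod_two_cases (sympForm p y) with h | h
  · exact ⟨y, h, hy⟩
  rcases zmod_two_cases (sympForm p y') with h' | h'
  · exact ⟨y', h', by simpa [h'] using hy'⟩
  · refine ⟨y + y', ?_, ?_⟩
    · rw [sympForm_add_right, h, h']; decide
    · rw [h'] at hy'
      rw [sympForm_add_right, hy]; exact hy'

/-- Two labels outside the span of `p` can be separated from `p` simultaneously. -/
theorem exists_sympForm_separating_pair {n : ℕ} {p q q' : Bits n × Bits n} (hq : q ≠ 0)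
    (hpq : q ≠ p) (hq' : q' ≠ 0) (hpq' : q' ≠ p) :
    ∃ z, sympForm p z = 0 ∧ sympForm q z = 1 ∧ sympForm q' z = 1 := by
  obtain ⟨z, h1, h2⟩ := exists_sympForm_separating hq hpq
  obtain ⟨z', h1', h2'⟩ := exists_sympForm_separating hq' hpq'
  rcases zmod_two_cases (sympForm q' z) with h | h
  · rcases zmod_two_cases (sympForm q z') with h' | h'
    · refine ⟨z + z', ?_, ?_, ?_⟩ <;> rw [sympForm_add_right] <;> simp [*]
    · exact ⟨z', h1', h', h2'⟩
  · exact ⟨z, h1, h2, h⟩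

/-- The symplectic transvection along `v`. -/
def transvection {n : ℕ} (v u : Bits n × Bits n) : Bits n × Bits n :=
  if sympForm u v = 1 then u + v else u

theorem transvection_of_one {n : ℕ} {v u : Bits n × Bits n} (h : sympForm u v = 1) :
    transvection v u = u + v := if_pos h

theorem transvection_of_zero {n : ℕ} {v u : Bits n × Bits n} (h : sympForm u v = 0) :
    transvection v u = u := if_neg (by rw [h]; decide)

/-- One transvection links any two anticommuting labels; this is the elementary move in the orbit
arguments below. -/
theorem transvection_add {n : ℕ} {u w : Bits n × Bits n} (h : sympForm u w = 1) :
    transvection (u + w) u = w := by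
  rw [transvection_of_one (by rw [sympForm_add_right, sympForm_self, h, zero_add]), ← add_assoc,
    label_add_self, zero_add]

/-- A function that is invariant under all transvections fixing `p` is constant on the labels
outside the span of `p` that are orthogonal to `p`. -/
theorem eq_of_transvection_invariant {n : ℕ} {β : Type*} {p : Bits n × Bits n}
    {g : Bits n × Bits n → β} (hg : ∀ v, sympForm p v = 0 → ∀ u, g (transvection v u) = g u)
    {q q' : Bits n × Bits n} (hq : q ≠ 0) (hpq : q ≠ p) (hq' : q' ≠ 0) (hpq' : q' ≠ p)
    (ho : sympForm p q = 0) (ho' : sympForm p q' = 0) : g q = g q' := by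
  have step : ∀ u w : Bits n × Bits n, sympForm p u = 0 → sympForm p w = 0 →
      sympForm u w = 1 → g u = g w := by
    intro u w hu hw h
    rw [← hg (u + w) (by rw [sympForm_add_right, hu, hw, add_zero]) u, transvection_add h]
  -- Two moves suffice: `q` goes to `z` and `z` to `q'`. Each transvection vector is a sum of labels
  -- orthogonal to `p`, hence is itself orthogonal to `p`.
  obtain ⟨z, h0, h1, h2⟩ := exists_sympForm_separating_pair hq hpq hq' hpq'
  rw [step q z ho h0 h1, step q' z ho' h0 h2]

/-! ### Clifford circuits realise all transvections -/

/-- The labels `v` for which a multiple of `1 ± i P_v` is a Clifford circuit. -/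
def cliffordAxes (n : ℕ) : Set (Bits n × Bits n) :=
  {v | ∃ U ∈ cliffordGroup n, ∃ z κ : ℂ, κ * κ = 1 ∧
    (U : QMat n) = z • (1 + (κ * Complex.I) • hermPauli v)}

/-- A Pauli matrix commuting with `P_v` is fixed. An anticommuting `P_u` passes through the first
factor by changing the sign of `P_v`, and the square of `1 ∓ i P_v` is `∓ 2 i P_v`, so the result is
`P_u * P_v` up to a scalar. -/
theorem one_add_pauli_conj {n : ℕ} {v u : Bits n × Bits n} {z κ : ℂ} (hκ : κ * κ = 1)
    (hU : z • (1 + (κ * Complex.I) • hermPauli v) ∈ Matrix.unitaryGroup (Bits n) ℂ) :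
    ∃ κ' : ℂ, κ' * κ' = 1 ∧ (z • (1 + (κ * Complex.I) • hermPauli v)) * hermPauli u *
      star (z • (1 + (κ * Complex.I) • hermPauli v)) = κ' • hermPauli (transvection v u) := by
  have hU' := Matrix.mem_unitaryGroup_iff.1 hU
  rcases zmod_two_cases (sympForm u v) with h | h
  · refine ⟨1, by ring, ?_⟩
    have hc := hermPauli_comm v u
    rw [sympForm_comm, h, bitSign_zero, one_smul] at hc
    have : (z • (1 + (κ * Complex.I) • hermPauli v)) * hermPauli u =
        hermPauli u * (z • (1 + (κ * Complex.I) • hermPauli v)) := by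
      simp only [Matrix.smul_mul, Matrix.mul_smul, add_mul, mul_add, one_mul, mul_one, hc]
    rw [this, mul_assoc, hU', transvection_of_zero h, mul_one, one_smul]
  · rw [transvection_of_one h]
    have hκs : star κ = κ := by
      have : (κ - 1) * (κ + 1) = 0 := by linear_combination hκ
      rcases mul_eq_zero.1 this with h | h
      · rw [sub_eq_zero.1 h]; simp
      · rw [eq_neg_of_add_eq_zero_left h]; simp
    have hstar : star (z • (1 + (κ * Complex.I) • hermPauli v)) =
        star z • (1 - (κ * Complex.I) • hermPauli v) := by
      rw [star_smul, star_add, star_smul, hermPauli_star, star_one, star_mul', hκs]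
      simp [sub_eq_add_neg]
    rw [hstar] at hU' ⊢
    obtain ⟨κ', hκ', hm⟩ := hermPauli_mul_of_sympForm_one h
    have hc := hermPauli_comm v u
    rw [sympForm_comm, h, bitSign_one, neg_one_smul] at hc
    have hsq := hermPauli_sq v
    -- Unitarity fixes the modulus of `z`, which is what makes the final scalar a sign.
    have hz : (z * star z) * 2 = 1 := by
      have e : z • (1 + (κ * Complex.I) • hermPauli v) *
          star z • (1 - (κ * Complex.I) • hermPauli v) = ((z * star z) * 2) • (1 : QMat n) := by
        simp only [Matrix.smul_mul, Matrix.mul_smul, add_mul, mul_sub, one_mul, mul_one, hsq,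
          smul_smul]
        have : κ * Complex.I * (κ * Complex.I) = -1 := by
          linear_combination Complex.I * Complex.I * hκ + Complex.I_mul_I
        linear_combination (norm := module) (-(z * star z) * this) • (1 : QMat n)
      rw [e] at hU'
      simpa using congrFun (congrFun hU' 0) 0
    refine ⟨κ * κ', by linear_combination κ' * κ' * hκ + hκ', ?_⟩
    have h1 : (1 + (κ * Complex.I) • hermPauli v) * hermPauli u *
        (1 - (κ * Complex.I) • hermPauli v) = (2 * κ * κ') • hermPauli (u + v) := by
      have e1 : (1 + (κ * Complex.I) • hermPauli v) * hermPauli u =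
          hermPauli u * (1 - (κ * Complex.I) • hermPauli v) := by
        simp only [Matrix.smul_mul, Matrix.mul_smul, add_mul, mul_sub, one_mul, mul_one, hc]
        module
      have e2 : (1 - (κ * Complex.I) • hermPauli v) * (1 - (κ * Complex.I) • hermPauli v) =
          (-2 * κ * Complex.I) • hermPauli v := by
        simp only [Matrix.smul_mul, Matrix.mul_smul, sub_mul, mul_sub, one_mul, mul_one, hsq,
          smul_smul]
        have : κ * Complex.I * (κ * Complex.I) = -1 := by
          linear_combination Complex.I * Complex.I * hκ + Complex.I_mul_I
        rw [this]; module
      rw [e1, mul_assoc, e2, Matrix.mul_smul, hm, smul_smul]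
      congr 1
      linear_combination (-2 * κ * κ') * Complex.I_mul_I
    rw [Matrix.smul_mul, Matrix.smul_mul, Matrix.mul_smul, h1, smul_smul, smul_smul]
    congr 1
    linear_combination (κ * κ') * hz

theorem cliffordAxes_of_conj {n : ℕ} {v w : Bits n × Bits n} (hv : v ∈ cliffordAxes n)
    {C : Matrix.unitaryGroup (Bits n) ℂ} (hC : C ∈ cliffordGroup n) {κ : ℂ} (hκ : κ * κ = 1)
    (h : (C : QMat n) * hermPauli v * star (C : QMat n) = κ • hermPauli w) :
    w ∈ cliffordAxes n := by
  obtain ⟨U, hU, z, κ', hκ', e⟩ := hv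
  refine ⟨C * U * C⁻¹, mul_mem (mul_mem hC hU) (inv_mem hC), z, κ' * κ,
    by linear_combination κ * κ * hκ' + hκ, ?_⟩
  have hr : (C : QMat n) * star (C : QMat n) = 1 := Matrix.mem_unitaryGroup_iff.1 C.2
  have : ((C * U * C⁻¹ : Matrix.unitaryGroup (Bits n) ℂ) : QMat n) =
      (C : QMat n) * (U : QMat n) * star (C : QMat n) := rfl
  rw [this, e, Matrix.mul_smul, Matrix.smul_mul, mul_add, add_mul, mul_one, hr, Matrix.mul_smul,
    Matrix.smul_mul, h, smul_smul]
  congr 3; ring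

/-- Conjugating the circuit of axis `v` by that of axis `w` applies the transvection along `w` to
the axis. This closure rule, started from the axes of the gates, reaches every nonzero label. -/
theorem cliffordAxes_add {n : ℕ} {v w : Bits n × Bits n} (hv : v ∈ cliffordAxes n)
    (hw : w ∈ cliffordAxes n) (h : sympForm v w = 1) : v + w ∈ cliffordAxes n := by
  obtain ⟨U, hU, z, κ, hκ, e⟩ := hw
  obtain ⟨κ', hκ', h'⟩ := one_add_pauli_conj (u := v) hκ (by rw [← e]; exact U.2)
  rw [← e, transvection_of_one h] at h'
  exact cliffordAxes_of_conj hv hU hκ' h'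

/-- The label that is `y` at qubit `j` and trivial elsewhere. -/
def singleLabel {n : ℕ} (j : Fin n) (y : ZMod 2 × ZMod 2) : Bits n × Bits n :=
  (Pi.single j y.1, Pi.single j y.2)

theorem singleLabel_add {n : ℕ} (j : Fin n) (y y' : ZMod 2 × ZMod 2) :
    singleLabel j (y + y') = singleLabel j y + singleLabel j y' := by
  simp [singleLabel, Pi.single_add]

theorem sympForm_singleLabel {n : ℕ} (u : Bits n × Bits n) (j : Fin n) (y : ZMod 2 × ZMod 2) :
    sympForm u (singleLabel j y) = u.1 j * y.2 + u.2 j * y.1 := by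
  simp [sympForm, singleLabel]

theorem singleLabel_same {n : ℕ} (j : Fin n) (y : ZMod 2 × ZMod 2) :
    (singleLabel j y).1 j = y.1 ∧ (singleLabel j y).2 j = y.2 := by
  simp [singleLabel]

theorem singleLabel_ne {n : ℕ} {j k : Fin n} (h : k ≠ j) (y : ZMod 2 × ZMod 2) :
    (singleLabel j y).1 k = 0 ∧ (singleLabel j y).2 k = 0 := by
  simp [singleLabel, h]

/-- Because `diag (1, i) = ((1 + i) / 2) * (1 - i Z)`. -/
theorem phase_axis {n : ℕ} (j : Fin n) : singleLabel j (0, 1) ∈ cliffordAxes n := by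
  refine ⟨⟨_, phaseMat_mem j⟩, Subgroup.subset_closure (Or.inr (Or.inl ⟨j, rfl⟩)),
    (1 + Complex.I) / 2, -1, by ring, ?_⟩
  ext x y
  simp only [phaseMat, Matrix.diagonal_apply, Matrix.smul_apply, Matrix.add_apply,
    Matrix.one_apply, hermPauli, singleLabel, pauliMat, Matrix.of_apply, Pi.single_zero, add_zero,
    smul_eq_mul, zero_dotProduct, ZMod.val_zero, pow_zero, single_dotProduct, one_mul]
  split_ifs with h
  · subst h
    rcases zmod_two_cases (x j) with h | h <;> rw [h]
    · rw [bitSign_zero, ZMod.val_zero]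
      linear_combination (1 / 2) * Complex.I_mul_I
    · rw [bitSign_one, ZMod.val_one]
      linear_combination (-1 / 2) * Complex.I_mul_I
  · simp

theorem conj_of_mul_eq {n : ℕ} {C : QMat n} (hC : C ∈ Matrix.unitaryGroup (Bits n) ℂ)
    {P Q : QMat n} (h : C * P = Q * C) : C * P * star C = (1 : ℂ) • Q := by
  rw [h, mul_assoc, Matrix.mem_unitaryGroup_iff.1 hC, mul_one, one_smul]

/-- The Hadamard gate conjugates `Z` to `X`. -/
theorem hadamard_axis {n : ℕ} (j : Fin n) : singleLabel j (1, 0) ∈ cliffordAxes n := by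
  refine cliffordAxes_of_conj (phase_axis j) (C := ⟨_, hadamardMat_mem j⟩)
    (Subgroup.subset_closure (Or.inl ⟨j, rfl⟩)) (κ := 1) (by ring)
    (conj_of_mul_eq (hadamardMat_mem j) ?_)
  ext x y
  have hX : hermPauli (singleLabel j (1, 0)) = pauliMat 1 (Pi.single j 1) 0 := by
    simp [hermPauli, singleLabel]
  rw [hadamardMat_mul_apply, hX, pauliMat_mul_apply, zero_dotProduct, bitSign_zero]
  have hoff : (∀ k, k ≠ j → (x + Pi.single j 1 : Bits n) k = y k) ↔
      (y = x ∨ y = x + Pi.single j 1) := by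
    rw [← bits_off_iff]
    constructor <;> intro h k hk <;> simpa [hk] using h k hk
  simp only [hadamardMat, hermPauli, singleLabel, pauliMat, Matrix.of_apply, hoff, Pi.single_zero,
    add_zero, zero_dotProduct, ZMod.val_zero, pow_zero, single_dotProduct, one_mul]
  have hne := bits_add_single_ne j x
  by_cases h1 : y = x
  · subst h1
    have h2 : ¬ (y + Pi.single j 1 = y) := fun h => hne h.symm
    rw [if_pos rfl, if_neg h2, if_pos (Or.inl rfl), add_zero, ← bitSign_add]
    congr 2
    have : ∀ a : ZMod 2, a + a = (a + 1) * a := by decide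
    simpa using this (y j)
  · by_cases h2 : y = x + Pi.single j 1
    · subst h2
      rw [if_neg hne, if_pos rfl, if_pos (Or.inr rfl)]
      have : ∀ a : ZMod 2, a + 1 = (a + 1) * (a + 1) := by decide
      simp [← this]
    · rw [if_neg (Ne.symm h1), if_neg (fun h => h2 h.symm), if_neg (by tauto)]; simp

/-- CNOT conjugates `X` on the control to `X` on both qubits; this supplies the only axes that
couple different qubits. -/
theorem cnot_axis {n : ℕ} {c t : Fin n} (hct : c ≠ t) :
    singleLabel c (1, 0) + singleLabel t (1, 0) ∈ cliffordAxes n := by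
  refine cliffordAxes_of_conj (hadamard_axis c) (C := ⟨_, cnotMat_mem hct⟩)
    (Subgroup.subset_closure (Or.inr (Or.inr ⟨c, t, hct, rfl⟩))) (κ := 1) (by ring)
    (conj_of_mul_eq (cnotMat_mem hct) ?_)
  ext x y
  have hX : hermPauli (singleLabel c (1, 0) + singleLabel t (1, 0)) =
      pauliMat 1 (Pi.single c 1 + Pi.single t 1) 0 := by
    simp [hermPauli, singleLabel]
  rw [cnotMat_mul_apply hct, hX, pauliMat_mul_apply, zero_dotProduct, bitSign_zero]
  simp only [cnotMat, hermPauli, singleLabel, pauliMat, Matrix.of_apply, Pi.single_zero,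
    dotProduct_zero, zero_dotProduct, bitSign_zero, ZMod.val_zero, pow_zero, one_mul]
  have hyy : ∀ a : Bits n, a + a = 0 := fun a => by ext k; exact CharTwo.add_self_eq_zero _
  have key : x + Pi.single t (x c) = y + Pi.single c 1 ↔
      x + (Pi.single c 1 + Pi.single t 1) = y + Pi.single t (y c) := by
    constructor
    · intro h
      have hc : x c = y c + 1 := by simpa [hct] using congrFun h c
      rw [hc, Pi.single_add] at h
      linear_combination h - hyy (Pi.single t (y c)) + hyy (Pi.single c 1)
    · intro h
      have hc : x c + 1 = y c := by simpa [hct] using congrFun h c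
      rw [← hc, Pi.single_add] at h
      linear_combination h - hyy (Pi.single c 1) + hyy (Pi.single t (x c))
  simp only [key]

section Generation

variable {n : ℕ}

theorem single_axis (j : Fin n) {y : ZMod 2 × ZMod 2} (hy : y ≠ 0) :
    singleLabel j y ∈ cliffordAxes n := by
  have hc : ∀ y : ZMod 2 × ZMod 2, y ≠ 0 → y = (1, 0) ∨ y = (0, 1) ∨ y = (1, 0) + (0, 1) := by
    decide
  rcases hc y hy with rfl | rfl | rfl
  · exact hadamard_axis j
  · exact phase_axis j
  · rw [singleLabel_add]
    refine cliffordAxes_add (hadamard_axis j) (phase_axis j) ?_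
    rw [sympForm_singleLabel, (singleLabel_same _ _).1, (singleLabel_same _ _).2]; decide

/-- A nontrivial component of an axis may be replaced by any other nontrivial one. -/
theorem axis_replace {u : Bits n × Bits n} (hu : u ∈ cliffordAxes n) {c : Fin n}
    {y : ZMod 2 × ZMod 2} (hc : (u.1 c, u.2 c) ≠ 0) (hy : y ≠ 0) :
    u + singleLabel c ((u.1 c, u.2 c) + y) ∈ cliffordAxes n := by
  have key : ∀ a y : ZMod 2 × ZMod 2, a ≠ 0 → y ≠ 0 → a + y = 0 ∨
      a + y ≠ 0 ∧ a.1 * (a + y).2 + a.2 * (a + y).1 = 1 := by decide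
  -- Two distinct nonzero vectors of the plane over `ZMod 2` have symplectic product 1, so either
  -- nothing changes or the closure rule applies to their sum.
  rcases key _ _ hc hy with h | ⟨h, h'⟩
  · have h0 : singleLabel c (0 : ZMod 2 × ZMod 2) = (0 : Bits n × Bits n) := by simp [singleLabel]
    rw [h, h0, add_zero]; exact hu
  · exact cliffordAxes_add hu (single_axis c h) (by rw [sympForm_singleLabel]; exact h')

theorem pair_axis {c t : Fin n} (hct : c ≠ t) {y y' : ZMod 2 × ZMod 2} (hy : y ≠ 0)
    (hy' : y' ≠ 0) : singleLabel c y + singleLabel t y' ∈ cliffordAxes n := by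
  have h1 := cnot_axis hct
  have e1 : ((singleLabel c (1, 0) + singleLabel t (1, 0)).1 c,
      (singleLabel c (1, 0) + singleLabel t (1, 0)).2 c) = ((1, 0) : ZMod 2 × ZMod 2) := by
    simp [singleLabel, hct]
  have h2 := axis_replace h1 (c := c) (by rw [e1]; decide) hy
  rw [e1, singleLabel_add, add_right_comm, ← add_assoc, label_add_self, zero_add] at h2
  have e2 : ((singleLabel c y + singleLabel t (1, 0)).1 t,
      (singleLabel c y + singleLabel t (1, 0)).2 t) = ((1, 0) : ZMod 2 × ZMod 2) := by
    simp [singleLabel, hct.symm]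
  have h3 := axis_replace h2 (c := t) (by rw [e2]; decide) hy'
  rwa [e2, singleLabel_add, add_assoc, ← add_assoc (singleLabel t _), label_add_self,
    zero_add] at h3

/-- The label to be added at `t` is orthogonal to `u`, so it cannot be added directly. An auxiliary
`x` at qubit `c`, anticommuting with the component of `u` there, is added together with it and then
removed. -/
theorem axis_extend {u : Bits n × Bits n} (hu : u ∈ cliffordAxes n) {c t : Fin n}
    (hct : c ≠ t) (hc : (u.1 c, u.2 c) ≠ 0) (ht : (u.1 t, u.2 t) = 0) {y : ZMod 2 × ZMod 2}
    (hy : y ≠ 0) : u + singleLabel t y ∈ cliffordAxes n := by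
  have key : ∀ a : ZMod 2 × ZMod 2, a ≠ 0 → ∃ x : ZMod 2 × ZMod 2, x ≠ 0 ∧
      a.1 * x.2 + a.2 * x.1 = 1 := by decide
  obtain ⟨x, hx, hax⟩ := key _ hc
  have ht1 : u.1 t = 0 := congrArg Prod.fst ht
  have ht2 : u.2 t = 0 := congrArg Prod.snd ht
  have h1 := cliffordAxes_add hu (pair_axis hct hx hy) (by
    rw [sympForm_add_right, sympForm_singleLabel, sympForm_singleLabel, ht1, ht2]
    simpa using hax)
  have h2 := cliffordAxes_add h1 (single_axis c hx) (by
    rw [sympForm_add_left, sympForm_add_left, sympForm_singleLabel, sympForm_comm (singleLabel t y),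
      sympForm_self, sympForm_singleLabel, (singleLabel_ne hct.symm x).1,
      (singleLabel_ne hct.symm x).2]
    simpa using hax)
  convert h2 using 1
  linear_combination -label_add_self (singleLabel c x)

/-- Every nontrivial label is an axis. -/
theorem mem_cliffordAxes {u : Bits n × Bits n} (hu : u ≠ 0) : u ∈ cliffordAxes n := by
  have main : ∀ S : Finset (Fin n), ∀ u : Bits n × Bits n,
      (∀ k, k ∉ S → (u.1 k, u.2 k) = 0) → u ≠ 0 → u ∈ cliffordAxes n := by
    intro S
    induction S using Finset.induction_on with
    | empty =>
      intro u h hu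
      exact absurd (Prod.ext (funext fun k => congrArg Prod.fst (h k (by simp)))
        (funext fun k => congrArg Prod.snd (h k (by simp)))) hu
    | insert t S ht ih =>
      intro u h hu
      by_cases hy : (u.1 t, u.2 t) = 0
      · refine ih u (fun k hk => ?_) hu
        by_cases hkt : k = t
        · rw [hkt, hy]
        · exact h k (by simp [hk, hkt])
      -- Strip the component at `t`. What remains is supported on `S`; it is either zero, leaving a
      -- one-qubit axis, or an axis by induction, to which the component is added back.
      set y : ZMod 2 × ZMod 2 := (u.1 t, u.2 t) with hydef
      set u' := u + singleLabel t y with hu'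
      have e : u = u' + singleLabel t y := by
        rw [hu', add_assoc, label_add_self, add_zero]
      have ht' : (u'.1 t, u'.2 t) = 0 := by
        simp [hu', singleLabel, hydef, CharTwo.add_self_eq_zero]
      by_cases h0 : u' = 0
      · rw [e, h0, zero_add]; exact single_axis t hy
      have hS : ∀ k, k ∉ S → (u'.1 k, u'.2 k) = 0 := by
        intro k hk
        by_cases hkt : k = t
        · rw [hkt, ht']
        · have := h k (by simp [hk, hkt])
          simpa [hu', singleLabel, hkt] using this
      have hm := ih u' hS h0
      have : ∃ c, (u'.1 c, u'.2 c) ≠ 0 := by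
        by_contra! hall
        exact h0 (Prod.ext (funext fun k => congrArg Prod.fst (hall k))
          (funext fun k => congrArg Prod.snd (hall k)))
      obtain ⟨c, hc⟩ := this
      rw [e]
      refine axis_extend hm (c := c) ?_ hc ht' hy
      rintro rfl
      exact hc ht'
  exact main Finset.univ u (by simp) hu

end Generation

/-- Clifford circuits realise all symplectic transvections on Pauli labels. -/
theorem exists_clifford_transvection {n : ℕ} (v : Bits n × Bits n) :
    ∃ U ∈ cliffordGroup n, ∀ u, ∃ κ : ℂ, κ * κ = 1 ∧
      (U : QMat n) * hermPauli u * star (U : QMat n) = κ • hermPauli (transvection v u) := by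
  by_cases hv : v = 0
  · subst hv
    refine ⟨1, one_mem _, fun u => ⟨1, by ring, ?_⟩⟩
    rw [transvection_of_zero (by rw [sympForm_comm, sympForm_zero_left])]
    simp
  · obtain ⟨U, hU, z, κ, hκ, e⟩ := mem_cliffordAxes hv
    exact ⟨U, hU, fun u => by rw [e]; exact one_add_pauli_conj hκ (by rw [← e]; exact U.2)⟩

/-- Pauli matrices are Clifford circuits up to phase. -/
theorem exists_clifford_pauli {n : ℕ} (v : Bits n × Bits n) :
    ∃ U ∈ cliffordGroup n, ∀ u, (U : QMat n) * hermPauli u * star (U : QMat n) =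
      bitSign (sympForm u v) • hermPauli u := by
  by_cases hv : v = 0
  · subst hv
    refine ⟨1, one_mem _, fun u => ?_⟩
    rw [sympForm_comm, sympForm_zero_left, bitSign_zero]
    simp
  · obtain ⟨U, hU, z, κ, hκ, e⟩ := mem_cliffordAxes hv
    refine ⟨U * U, mul_mem hU hU, fun u => ?_⟩
    have hr := Matrix.mem_unitaryGroup_iff.1 (U * U).2
    -- The square of `1 ± i P` is `± 2 i P`, so squaring the circuit leaves a multiple of the Pauli
    -- matrix.
    have hsq : ((U * U : Matrix.unitaryGroup (Bits n) ℂ) : QMat n) =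
        (z * z * (2 * κ * Complex.I)) • hermPauli v := by
      have : ((U * U : Matrix.unitaryGroup (Bits n) ℂ) : QMat n) = (U : QMat n) * U := rfl
      rw [this, e]
      simp only [Matrix.smul_mul, Matrix.mul_smul, add_mul, mul_add, one_mul, mul_one,
        hermPauli_sq, smul_smul]
      have : κ * Complex.I * (κ * Complex.I) = -1 := by
        linear_combination Complex.I * Complex.I * hκ + Complex.I_mul_I
      linear_combination (norm := module) ((z * z) * this) • (1 : QMat n)
    rw [hsq] at hr ⊢
    have hc : ∀ c : ℂ, (c • hermPauli v) * hermPauli u =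
        bitSign (sympForm u v) • (hermPauli u * (c • hermPauli v)) := by
      intro c
      rw [Matrix.smul_mul, hermPauli_comm v u, sympForm_comm, smul_comm, Matrix.mul_smul]
    rw [hc, Matrix.smul_mul, mul_assoc, hr, mul_one]

/-! ### Pauli correlations of stabilizer states, computed by symmetry -/

/-- Averages over stabilizer states are invariant under Clifford circuits. -/
theorem sum_stab_conj {n : ℕ} {U : Matrix.unitaryGroup (Bits n) ℂ} (hU : U ∈ cliffordGroup n)
    (F : QMat n → ℂ) :
    ∑ s : StabState n, F (star (U : QMat n) * s.proj * (U : QMat n)) =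
      ∑ s : StabState n, F s.proj := by
  have hr : (U : QMat n) * star (U : QMat n) = 1 := Matrix.mem_unitaryGroup_iff.1 U.2
  have hmem : ∀ s : StabState n,
      star (U : QMat n) * s.proj * (U : QMat n) ∈ stabilizerStates n := by
    intro s
    have h := clifford_conj_stab (inv_mem hU) s
    have e : ((U⁻¹ : Matrix.unitaryGroup (Bits n) ℂ) : QMat n) = star (U : QMat n) := rfl
    rwa [e, star_star] at h
  let f : StabState n → StabState n := fun s => ⟨_, hmem s⟩
  have hf : Function.Injective f := by
    intro s t h
    have h1 : star (U : QMat n) * s.proj * (U : QMat n) =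
        star (U : QMat n) * t.proj * (U : QMat n) := congrArg Subtype.val h
    have h2 := congrArg (fun T => (U : QMat n) * T * star (U : QMat n)) h1
    have h3 : s.proj = t.proj := by
      simpa [mul_assoc, hr, ← mul_assoc (U : QMat n) (star (U : QMat n))] using h2
    exact Subtype.ext h3
  exact Function.Bijective.sum_comp (Finite.injective_iff_bijective.1 hf) fun s => F s.proj

theorem stab_proj_mul_mul {n : ℕ} (s : StabState n) (A : QMat n) :
    s.proj * A * s.proj = Matrix.trace (s.proj * A) • s.proj := by
  obtain ⟨P, C, hC, b, rfl⟩ := s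
  simp only [StabState.proj]
  rw [Matrix.vecMulVec_mul, Matrix.vecMulVec_mul_vecMulVec, Matrix.trace_vecMulVec,
    dotProduct_comm]
  ext x y
  simp only [Matrix.vecMulVec_apply, Matrix.smul_apply, Pi.smul_apply, smul_eq_mul]
  ring

theorem stab_proj_star {n : ℕ} (s : StabState n) : star s.proj = s.proj := by
  obtain ⟨P, C, hC, b, rfl⟩ := s
  simp only [StabState.proj]
  rw [Matrix.star_eq_conjTranspose, Matrix.conjTranspose_vecMulVec, star_star]

/-- Parseval's identity for the Pauli basis. -/
theorem sum_trace_mul_trace {n : ℕ} (A M : QMat n) :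
    ∑ u, Matrix.trace (A * hermPauli u) * Matrix.trace (M * hermPauli u) =
      2 ^ n * Matrix.trace (M * A) := by
  have h := congrArg (fun T => Matrix.trace (M * T)) (sum_trace_smul_hermPauli A)
  simpa [Finset.mul_sum, Matrix.trace_sum] using h

theorem trace_conj_mul {n : ℕ} (U S P : QMat n) :
    Matrix.trace (star U * S * U * P) = Matrix.trace (S * (U * P * star U)) := by
  rw [mul_assoc, mul_assoc, Matrix.trace_mul_comm]
  simp only [mul_assoc]

/-- The sum over stabilizer states of a product of three Pauli expectation values vanishes unless
the labels add up to zero. -/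
theorem sum_stab_pauli_eq_zero {n : ℕ} {p q r : Bits n × Bits n} (h : p + q + r ≠ 0) :
    ∑ s : StabState n, Matrix.trace (s.proj * hermPauli p) * Matrix.trace (s.proj * hermPauli q) *
      Matrix.trace (s.proj * hermPauli r) = 0 := by
  -- Conjugation by `P_v` preserves the sum over states and multiplies the summand by the sign of
  -- `sympForm (p + q + r) v`, which is `-1`.
  obtain ⟨v, hv⟩ := exists_sympForm_eq_one h
  obtain ⟨U, hU, hconj⟩ := exists_clifford_pauli v
  have h1 := sum_stab_conj hU fun S => Matrix.trace (S * hermPauli p) *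
    Matrix.trace (S * hermPauli q) * Matrix.trace (S * hermPauli r)
  simp only [trace_conj_mul, hconj, Matrix.mul_smul, Matrix.trace_smul, smul_eq_mul] at h1
  have h2 : bitSign (sympForm p v) * bitSign (sympForm q v) * bitSign (sympForm r v) = -1 := by
    rw [← bitSign_add, ← bitSign_add, ← sympForm_add_left, ← sympForm_add_left, hv, bitSign_one]
  have h3 : ∀ s : StabState n, bitSign (sympForm p v) * Matrix.trace (s.proj * hermPauli p) *
      (bitSign (sympForm q v) * Matrix.trace (s.proj * hermPauli q)) *
      (bitSign (sympForm r v) * Matrix.trace (s.proj * hermPauli r)) =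
      -(Matrix.trace (s.proj * hermPauli p) * Matrix.trace (s.proj * hermPauli q) *
      Matrix.trace (s.proj * hermPauli r)) := fun s => by
    linear_combination (Matrix.trace (s.proj * hermPauli p) * Matrix.trace (s.proj * hermPauli q) *
      Matrix.trace (s.proj * hermPauli r)) * h2
  simp only [h3, Finset.sum_neg_distrib] at h1
  linear_combination (-1 / 2) * h1

/-- The sum over stabilizer states of the expectation values of two Pauli matrices and of their
product. -/
noncomputable def pauliCorr {n : ℕ} (p q : Bits n × Bits n) : ℂ :=
  ∑ s : StabState n, Matrix.trace (s.proj * hermPauli p) * Matrix.trace (s.proj * hermPauli q) *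
    Matrix.trace (s.proj * (hermPauli p * hermPauli q))

/-- Each sign `κ`, `κ'` occurs twice, in a single factor and in the product, and squares to 1.
Having the matrix product in `pauliCorr` instead of the Pauli matrix of the label `p + q` avoids
tracking phases. -/
theorem pauliCorr_transvection {n : ℕ} (v p q : Bits n × Bits n) :
    pauliCorr (transvection v p) (transvection v q) = pauliCorr p q := by
  obtain ⟨U, hU, hconj⟩ := exists_clifford_transvection v
  obtain ⟨κ, hκ, hp⟩ := hconj p
  obtain ⟨κ', hκ', hq⟩ := hconj q
  have hl : star (U : QMat n) * (U : QMat n) = 1 := Matrix.mem_unitaryGroup_iff'.1 U.2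
  have hpq : (U : QMat n) * (hermPauli p * hermPauli q) * star (U : QMat n) =
      (κ * κ') • (hermPauli (transvection v p) * hermPauli (transvection v q)) := by
    rw [← smul_smul, ← Matrix.mul_smul, ← hq, ← Matrix.smul_mul, ← hp]
    simp only [mul_assoc]
    rw [← mul_assoc (star (U : QMat n)) (U : QMat n), hl, one_mul]
  have h1 := sum_stab_conj hU fun S => Matrix.trace (S * hermPauli p) *
    Matrix.trace (S * hermPauli q) * Matrix.trace (S * (hermPauli p * hermPauli q))
  simp only [trace_conj_mul, hp, hq, hpq, Matrix.mul_smul, Matrix.trace_smul, smul_eq_mul] at h1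
  rw [pauliCorr, pauliCorr, ← h1]
  refine Finset.sum_congr rfl fun s _ => ?_
  linear_combination -(Matrix.trace (s.proj * hermPauli (transvection v p)) *
    Matrix.trace (s.proj * hermPauli (transvection v q)) *
    Matrix.trace (s.proj * (hermPauli (transvection v p) * hermPauli (transvection v q)))) *
    (κ * κ * hκ' + hκ)

/-- The transvection along `p + q` exchanges `p` and `q`, while the exchange reverses an
anticommuting product and so changes the sign. -/
theorem pauliCorr_of_anticomm {n : ℕ} {p q : Bits n × Bits n} (h : sympForm p q = 1) :
    pauliCorr p q = 0 := by
  have h1 := pauliCorr_transvection (p + q) p q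
  rw [transvection_add h] at h1
  have h2 : transvection (p + q) q = p := by
    rw [add_comm]; exact transvection_add (by rw [sympForm_comm]; exact h)
  rw [h2] at h1
  have h3 : pauliCorr q p = -pauliCorr p q := by
    rw [pauliCorr, pauliCorr, ← Finset.sum_neg_distrib]
    refine Finset.sum_congr rfl fun s _ => ?_
    rw [hermPauli_comm p q, h, bitSign_one, Matrix.mul_smul, Matrix.trace_smul, smul_eq_mul]
    ring
  rw [h3] at h1
  linear_combination (-1 / 2) * h1

theorem pauliCorr_zero_left {n : ℕ} (q : Bits n × Bits n) : pauliCorr 0 q =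
    ∑ s : StabState n, Matrix.trace (s.proj * hermPauli q) * Matrix.trace (s.proj * hermPauli q) := by
  simp [pauliCorr, hermPauli_zero, stab_trace]

theorem pauliCorr_zero_right {n : ℕ} (q : Bits n × Bits n) :
    pauliCorr q 0 = pauliCorr 0 q := by
  simp [pauliCorr, hermPauli_zero, stab_trace]

theorem pauliCorr_self {n : ℕ} (q : Bits n × Bits n) : pauliCorr q q = pauliCorr 0 q := by
  rw [pauliCorr_zero_left]; simp [pauliCorr, hermPauli_sq, stab_trace]

/-- For a fixed state `s`, Parseval's identity sums over `q` to `2 ^ n * tr (s P_p s)`, and `s P_p s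
= tr (s P_p) s` because `s` has rank one. This sum rule is the normalisation that symmetry alone
does not provide. -/
theorem sum_pauliCorr {n : ℕ} (p : Bits n × Bits n) :
    ∑ q, pauliCorr p q = 2 ^ n * pauliCorr 0 p := by
  rw [pauliCorr_zero_left, Finset.mul_sum]
  simp only [pauliCorr]
  rw [Finset.sum_comm]
  refine Finset.sum_congr rfl fun s _ => ?_
  have h := sum_trace_mul_trace s.proj (s.proj * hermPauli p)
  rw [stab_proj_mul_mul, Matrix.trace_smul, stab_trace, smul_eq_mul, mul_one] at h
  rw [mul_left_comm, ← h, Finset.mul_sum]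
  refine Finset.sum_congr rfl fun q _ => ?_
  rw [mul_assoc s.proj]; ring

theorem two_pow_ne_of_label_ne_zero {n : ℕ} {q : Bits n × Bits n} (hq : q ≠ 0) :
    (2 : ℂ) ^ n - 1 ≠ 0 := by
  have hn : n ≠ 0 := by
    rintro rfl
    exact hq (Subsingleton.elim _ _)
  rw [sub_ne_zero]
  intro h
  have : 2 ^ n = 1 := by exact_mod_cast h
  exact hn (by simpa using this)

theorem sum_ite_label {n : ℕ} (c : ℂ) (p : Bits n × Bits n) :
    ∑ q, (if q = p then c else 0) = c := by simp

theorem card_label (n : ℕ) : (Fintype.card (Bits n × Bits n) : ℂ) = 2 ^ n * 2 ^ n := by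
  simp

theorem pauliCorr_zero_of_ne {n : ℕ} {q : Bits n × Bits n} (hq : q ≠ 0) :
    (2 ^ n + 1) * pauliCorr 0 q = Fintype.card (StabState n) := by
  have h0 : pauliCorr (0 : Bits n × Bits n) 0 = Fintype.card (StabState n) := by
    simp [pauliCorr, hermPauli_zero, stab_trace]
  have hconst : ∀ u : Bits n × Bits n,
      pauliCorr 0 u = pauliCorr 0 q +
        if u = 0 then pauliCorr (0 : Bits n × Bits n) 0 - pauliCorr 0 q else 0 := by
    intro u
    split_ifs with hu
    · rw [hu]; ring
    · rw [add_zero]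
      refine eq_of_transvection_invariant (p := 0) (g := fun u => pauliCorr 0 u) ?_ hu hu hq hq
        (sympForm_zero_left _) (sympForm_zero_left _)
      intro v hv w
      have := pauliCorr_transvection v 0 w
      rwa [transvection_of_zero hv] at this
  have hs := sum_pauliCorr (0 : Bits n × Bits n)
  rw [Finset.sum_congr rfl fun u _ => hconst u, Finset.sum_add_distrib, sum_ite_label,
    Finset.sum_const, nsmul_eq_mul, Finset.card_univ, card_label, h0] at hs
  -- With a common value `a` on the nonzero labels, the sum rule reads `|STAB| + (D ^ 2 - 1) a = D
  -- |STAB|`. The factor `D - 1` is nonzero, since a nonzero label requires a qubit.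
  apply mul_left_cancel₀ (two_pow_ne_of_label_ne_zero hq)
  linear_combination hs

/-- This excludes the commuting case at `D = 2`, where the linear equation for the common
correlation degenerates. -/
theorem sympForm_eq_one_of_bits_one : ∀ p q : Bits 1 × Bits 1, p ≠ 0 → q ≠ 0 → q ≠ p →
    sympForm p q ≠ 0 := by
  unfold sympForm; decide

theorem pauliCorr_eq {n : ℕ} {p : Bits n × Bits n} (hp : p ≠ 0) (q : Bits n × Bits n) :
    (2 ^ n + 1) * (2 ^ n + 2) * pauliCorr p q = Fintype.card (StabState n) *
      (1 + bitSign (sympForm p q) + ((if q = 0 then 2 ^ n else 0) + if q = p then 2 ^ n else 0)) := by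
  have ha := pauliCorr_zero_of_ne hp
  by_cases hq : q = 0
  · subst hq
    rw [if_pos rfl, if_neg hp.symm, sympForm_comm, sympForm_zero_left, bitSign_zero,
      pauliCorr_zero_right]
    linear_combination (2 ^ n + 2) * ha
  by_cases hqp : q = p
  · subst hqp
    rw [if_neg hp, if_pos rfl, sympForm_self, bitSign_zero, pauliCorr_self]
    linear_combination (2 ^ n + 2) * ha
  rw [if_neg hq, if_neg hqp]
  rcases zmod_two_cases (sympForm p q) with ho | ho
  swap
  · rw [ho, bitSign_one, pauliCorr_of_anticomm ho]; ring
  rw [ho, bitSign_zero]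
  -- Transvections fixing `p` act transitively on the labels orthogonal to `p` outside `{0, p}`, so
  -- one value describes them all; the indicator of orthogonality is half of one plus the sign.
  have hconst : ∀ u : Bits n × Bits n, pauliCorr p u =
      pauliCorr p q / 2 * (1 + bitSign (sympForm p u)) +
        ((if u = 0 then pauliCorr 0 p - pauliCorr p q else 0) +
          if u = p then pauliCorr 0 p - pauliCorr p q else 0) := by
    intro u
    by_cases hu : u = 0
    · subst hu
      rw [if_pos rfl, if_neg hp.symm, sympForm_comm, sympForm_zero_left, bitSign_zero,
        pauliCorr_zero_right]; ring
    by_cases hup : u = p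
    · subst hup
      rw [if_neg hp, if_pos rfl, sympForm_self, bitSign_zero, pauliCorr_self]; ring
    rw [if_neg hu, if_neg hup]
    rcases zmod_two_cases (sympForm p u) with ho' | ho'
    · rw [ho', bitSign_zero]
      have := eq_of_transvection_invariant (p := p) (g := fun u => pauliCorr p u) (fun v hv w => by
        have := pauliCorr_transvection v p w
        rwa [transvection_of_zero hv] at this) hu hup hq hqp ho' ho
      rw [this]; ring
    · rw [ho', bitSign_one, pauliCorr_of_anticomm ho']; ring
  have hs := sum_pauliCorr p
  rw [Finset.sum_congr rfl fun u _ => hconst u, Finset.sum_add_distrib, Finset.sum_add_distrib,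
    sum_ite_label, sum_ite_label, ← Finset.mul_sum, Finset.sum_add_distrib,
    sum_bitSign_sympForm hp, Finset.sum_const, nsmul_eq_mul, Finset.card_univ, card_label] at hs
  -- Half of the `D ^ 2` labels are orthogonal to `p`. With `b` the unknown value and `a` the value
  -- at `0` and `p`, the sum rule becomes `(D ^ 2 / 2) b + 2 (a - b) = D a`, that is `(D - 2) (D +
  -- 2) b = 2 (D - 2) a`.
  have h2 : (2 : ℂ) ^ n - 2 ≠ 0 := by
    rw [sub_ne_zero]
    intro h
    have h1 : 2 ^ n = 2 ^ 1 := by rw [pow_one]; exact_mod_cast h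
    have : n = 1 := Nat.pow_right_injective le_rfl h1
    subst this
    exact sympForm_eq_one_of_bits_one p q hp hq hqp ho
  apply mul_left_cancel₀ h2
  linear_combination 2 * (2 ^ n + 1) * hs + 2 * (2 ^ n - 2) * ha

/-! ### Second and third moments of stabilizer states -/

section Moments

variable {n : ℕ}

theorem stab_trace_mul_expand (s : StabState n) (A : QMat n) :
    2 ^ n * Matrix.trace (s.proj * A) =
      ∑ u, Matrix.trace (A * hermPauli u) * Matrix.trace (s.proj * hermPauli u) :=
  (sum_trace_mul_trace A s.proj).symm

/-- Second moments of the uniform distribution on stabilizer states. -/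
theorem stab_two_design (ρ A : QMat n) (hA : A.trace = 0) :
    2 ^ n * (2 ^ n + 1) * ∑ s : StabState n, Matrix.trace (s.proj * ρ) * Matrix.trace (s.proj * A) =
      Fintype.card (StabState n) * Matrix.trace (ρ * A) := by
  have h1 : ∑ s : StabState n, (2 ^ n * Matrix.trace (s.proj * ρ)) *
      (2 ^ n * Matrix.trace (s.proj * A)) = ∑ u, ∑ v,
        (Matrix.trace (ρ * hermPauli u) * Matrix.trace (A * hermPauli v)) *
        ∑ s : StabState n, Matrix.trace (s.proj * hermPauli u) *
          Matrix.trace (s.proj * hermPauli v) := by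
    simp only [Finset.mul_sum (s := Finset.univ (α := StabState n))]
    rw [Finset.sum_congr rfl fun u _ => Finset.sum_comm, Finset.sum_comm]
    refine Finset.sum_congr rfl fun s _ => ?_
    rw [stab_trace_mul_expand, stab_trace_mul_expand, Finset.sum_mul_sum]
    refine Finset.sum_congr rfl fun u _ => ?_
    refine Finset.sum_congr rfl fun v _ => ?_
    ring
  -- Only equal labels correlate. Among those, the zero label has a different weight, but it is
  -- absent because `A` is traceless.
  have h2 : ∀ u v : Bits n × Bits n,
      (2 ^ n + 1) * ((Matrix.trace (ρ * hermPauli u) * Matrix.trace (A * hermPauli v)) *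
        ∑ s : StabState n, Matrix.trace (s.proj * hermPauli u) *
          Matrix.trace (s.proj * hermPauli v)) =
      if v = u then Fintype.card (StabState n) *
        (Matrix.trace (A * hermPauli u) * Matrix.trace (ρ * hermPauli u)) else 0 := by
    intro u v
    split_ifs with h
    · subst h
      by_cases hv : v = 0
      · subst hv; simp [hermPauli_zero, hA]
      · rw [← pauliCorr_zero_left]
        linear_combination (Matrix.trace (ρ * hermPauli v) * Matrix.trace (A * hermPauli v)) *
          pauliCorr_zero_of_ne hv
    · have h0 : u + v + 0 ≠ 0 := by
        rw [add_zero]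
        intro h0
        rw [← label_add_self v, add_left_inj] at h0
        exact h h0.symm
      have := sum_stab_pauli_eq_zero h0
      simp only [hermPauli_zero, mul_one, stab_trace] at this
      rw [this]; ring
  have h3 : (2 ^ n + 1) * ∑ s : StabState n, (2 ^ n * Matrix.trace (s.proj * ρ)) *
      (2 ^ n * Matrix.trace (s.proj * A)) = Fintype.card (StabState n) *
        (2 ^ n * Matrix.trace (ρ * A)) := by
    rw [h1, ← sum_trace_mul_trace A ρ]
    simp only [Finset.mul_sum (s := Finset.univ (α := Bits n × Bits n)), h2]
    simp
  have h4 : ∑ s : StabState n, (2 ^ n * Matrix.trace (s.proj * ρ)) *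
      (2 ^ n * Matrix.trace (s.proj * A)) = 2 ^ n * (2 ^ n *
        ∑ s : StabState n, Matrix.trace (s.proj * ρ) * Matrix.trace (s.proj * A)) := by
    simp only [Finset.mul_sum]
    exact Finset.sum_congr rfl fun s _ => by ring
  rw [h4] at h3
  have hD : (2 : ℂ) ^ n ≠ 0 := by positivity
  apply mul_left_cancel₀ hD
  linear_combination h3

/-- In the Pauli expansion of `ρ` only the label `p + q` survives. The phase relating its Pauli
matrix to the product cancels against its conjugate from the reversed product. -/
theorem sum_stab_pauli_pair (ρ : QMat n) (p q : Bits n × Bits n) :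
    2 ^ n * ∑ s : StabState n, Matrix.trace (s.proj * hermPauli p) *
      Matrix.trace (s.proj * hermPauli q) * Matrix.trace (s.proj * ρ) =
    Matrix.trace (ρ * (hermPauli q * hermPauli p)) * pauliCorr p q := by
  obtain ⟨z, hz, -, hm⟩ := hermPauli_mul p q
  have hm' : hermPauli q * hermPauli p = star z • hermPauli (p + q) := by
    have := congrArg star hm
    rwa [star_mul, star_smul, hermPauli_star, hermPauli_star, hermPauli_star] at this
  have hC : pauliCorr p q = z * ∑ s : StabState n, Matrix.trace (s.proj * hermPauli p) *
      Matrix.trace (s.proj * hermPauli q) * Matrix.trace (s.proj * hermPauli (p + q)) := by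
    rw [pauliCorr, Finset.mul_sum]
    refine Finset.sum_congr rfl fun s _ => ?_
    rw [hm, Matrix.mul_smul, Matrix.trace_smul, smul_eq_mul]; ring
  have h1 : 2 ^ n * ∑ s : StabState n, Matrix.trace (s.proj * hermPauli p) *
      Matrix.trace (s.proj * hermPauli q) * Matrix.trace (s.proj * ρ) =
      ∑ r, Matrix.trace (ρ * hermPauli r) * ∑ s : StabState n,
        Matrix.trace (s.proj * hermPauli p) * Matrix.trace (s.proj * hermPauli q) *
          Matrix.trace (s.proj * hermPauli r) := by
    simp only [Finset.mul_sum]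
    rw [Finset.sum_comm]
    refine Finset.sum_congr rfl fun s _ => ?_
    rw [mul_left_comm, stab_trace_mul_expand, Finset.mul_sum]
    exact Finset.sum_congr rfl fun r _ => by ring
  rw [h1, Finset.sum_eq_single (p + q), hC, hm', Matrix.mul_smul, Matrix.trace_smul, smul_eq_mul]
  · linear_combination -(Matrix.trace (ρ * hermPauli (p + q)) *
      ∑ s : StabState n, Matrix.trace (s.proj * hermPauli p) *
      Matrix.trace (s.proj * hermPauli q) * Matrix.trace (s.proj * hermPauli (p + q))) * hz
  · intro r _ hr
    rw [sum_stab_pauli_eq_zero, mul_zero]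
    intro h0
    rw [← label_add_self r, add_left_inj] at h0
    exact hr h0.symm
  · simp

theorem sum_trace_pauli_pair (ρ A : QMat n) :
    ∑ p, ∑ q, Matrix.trace (A * hermPauli p) * Matrix.trace (A * hermPauli q) *
      Matrix.trace (ρ * (hermPauli q * hermPauli p)) = 2 ^ n * 2 ^ n * Matrix.trace (ρ * (A * A)) := by
  have h : (2 ^ n : ℂ) • A * (2 ^ n : ℂ) • A = ((2 : ℂ) ^ n * 2 ^ n) • (A * A) := by
    rw [Matrix.smul_mul, Matrix.mul_smul, smul_smul]
  have h2 := congrArg (fun T => Matrix.trace (ρ * T)) h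
  simp only [← sum_trace_smul_hermPauli A] at h2
  rw [Finset.sum_mul_sum, Finset.sum_comm] at h2
  simp only [Matrix.mul_smul, Matrix.trace_smul, smul_eq_mul] at h2
  rw [← h2]
  simp only [Finset.mul_sum, Matrix.trace_sum, Matrix.smul_mul, Matrix.mul_smul,
    Matrix.trace_smul, smul_eq_mul]
  refine Finset.sum_congr rfl fun p _ => Finset.sum_congr rfl fun q _ => ?_
  ring

/-- Third moments of the uniform distribution on stabilizer states. -/
theorem stab_three_design (ρ A : QMat n) (hA : A.trace = 0) :
    2 ^ n * (2 ^ n + 1) * (2 ^ n + 2) * ∑ s : StabState n, Matrix.trace (s.proj * ρ) *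
      (Matrix.trace (s.proj * A) * Matrix.trace (s.proj * A)) =
    Fintype.card (StabState n) * (2 * Matrix.trace (ρ * (A * A)) +
      Matrix.trace ρ * Matrix.trace (A * A)) := by
  have h1 : ∑ s : StabState n, Matrix.trace (s.proj * ρ) *
      ((2 ^ n * Matrix.trace (s.proj * A)) * (2 ^ n * Matrix.trace (s.proj * A))) =
      ∑ p, ∑ q, (Matrix.trace (A * hermPauli p) * Matrix.trace (A * hermPauli q)) *
        ∑ s : StabState n, Matrix.trace (s.proj * hermPauli p) *
          Matrix.trace (s.proj * hermPauli q) * Matrix.trace (s.proj * ρ) := by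
    simp only [Finset.mul_sum (s := Finset.univ (α := StabState n))]
    rw [Finset.sum_congr rfl fun u _ => Finset.sum_comm, Finset.sum_comm]
    refine Finset.sum_congr rfl fun s _ => ?_
    rw [stab_trace_mul_expand, Finset.sum_mul_sum, Finset.mul_sum]
    refine Finset.sum_congr rfl fun u _ => ?_
    rw [Finset.mul_sum]
    refine Finset.sum_congr rfl fun v _ => ?_
    ring
  -- The factor `1 + bitSign (sympForm p q)` from `pauliCorr_eq` symmetrises the two orders of the
  -- product, so each order contributes one `tr (ρ A ^ 2)`; the diagonal correction contributes `tr
  -- ρ * tr (A ^ 2)`.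
  have h2 : ∀ p q : Bits n × Bits n, 2 ^ n * (2 ^ n + 1) * (2 ^ n + 2) *
      ((Matrix.trace (A * hermPauli p) * Matrix.trace (A * hermPauli q)) *
        ∑ s : StabState n, Matrix.trace (s.proj * hermPauli p) *
          Matrix.trace (s.proj * hermPauli q) * Matrix.trace (s.proj * ρ)) =
      Fintype.card (StabState n) * (Matrix.trace (A * hermPauli p) *
        Matrix.trace (A * hermPauli q) * Matrix.trace (ρ * (hermPauli q * hermPauli p))) +
      (Fintype.card (StabState n) * (Matrix.trace (A * hermPauli q) *
        Matrix.trace (A * hermPauli p) * Matrix.trace (ρ * (hermPauli p * hermPauli q))) +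
      if q = p then Fintype.card (StabState n) * (2 ^ n * Matrix.trace ρ) *
        (Matrix.trace (A * hermPauli p) * Matrix.trace (A * hermPauli p)) else 0) := by
    intro p q
    by_cases hp : p = 0
    · subst hp
      simp [hermPauli_zero, hA]
    by_cases hq : q = 0
    · subst hq
      simp only [hermPauli_zero, mul_one, hA, mul_zero, zero_mul, zero_add, if_neg (Ne.symm hp)]
    have e := pauliCorr_eq hp q
    rw [if_neg hq, zero_add] at e
    have e2 := sum_stab_pauli_pair ρ p q
    rw [hermPauli_comm p q, Matrix.mul_smul, Matrix.trace_smul, smul_eq_mul]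
    split_ifs with h
    · subst h
      rw [if_pos rfl, sympForm_self, bitSign_zero] at e
      rw [sympForm_self, bitSign_zero]
      rw [hermPauli_sq, mul_one] at *
      linear_combination (2 ^ n + 1) * (2 ^ n + 2) * (Matrix.trace (A * hermPauli q) *
        Matrix.trace (A * hermPauli q)) * e2 + (Matrix.trace (A * hermPauli q) *
        Matrix.trace (A * hermPauli q)) * Matrix.trace ρ * e
    · rw [if_neg h] at e
      linear_combination (2 ^ n + 1) * (2 ^ n + 2) * (Matrix.trace (A * hermPauli p) *
        Matrix.trace (A * hermPauli q)) * e2 + (Matrix.trace (A * hermPauli p) *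
        Matrix.trace (A * hermPauli q)) *
        Matrix.trace (ρ * (hermPauli q * hermPauli p)) * e
  have h3 : 2 ^ n * (2 ^ n + 1) * (2 ^ n + 2) * ∑ s : StabState n, Matrix.trace (s.proj * ρ) *
      ((2 ^ n * Matrix.trace (s.proj * A)) * (2 ^ n * Matrix.trace (s.proj * A))) =
      Fintype.card (StabState n) * (2 ^ n * 2 ^ n * Matrix.trace (ρ * (A * A))) +
      (Fintype.card (StabState n) * (2 ^ n * 2 ^ n * Matrix.trace (ρ * (A * A))) +
        Fintype.card (StabState n) * (2 ^ n * Matrix.trace ρ) * (2 ^ n * Matrix.trace (A * A))) := by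
    have hs := sum_trace_pauli_pair ρ A
    have hs' := hs
    rw [Finset.sum_comm] at hs'
    rw [h1, Finset.mul_sum, Finset.sum_congr rfl fun p _ => Finset.mul_sum _ _ _]
    simp only [h2, Finset.sum_add_distrib, ← Finset.mul_sum]
    rw [hs, hs', ← sum_trace_mul_trace A A, Finset.mul_sum]
    simp
  have h4 : ∑ s : StabState n, Matrix.trace (s.proj * ρ) *
      ((2 ^ n * Matrix.trace (s.proj * A)) * (2 ^ n * Matrix.trace (s.proj * A))) =
      2 ^ n * 2 ^ n * ∑ s : StabState n, Matrix.trace (s.proj * ρ) *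
      (Matrix.trace (s.proj * A) * Matrix.trace (s.proj * A)) := by
    rw [Finset.mul_sum]
    exact Finset.sum_congr rfl fun s _ => by ring
  rw [h4] at h3
  have hD : (2 : ℂ) ^ n ≠ 0 := by positivity
  apply mul_left_cancel₀ (mul_ne_zero hD hD)
  linear_combination h3

end Moments

/-! ### Nets of unit vectors -/

/-- A finite-dimensional complex inner product space has a small finite set of unit vectors that
has large overlap with every unit vector. -/
theorem exists_unit_net (E : Type*) [NormedAddCommGroup E] [InnerProductSpace ℂ E]
    [FiniteDimensional ℂ E] :
    ∃ T : Finset E, T.card ≤ 25 ^ Module.finrank ℂ E ∧ (∀ w ∈ T, ‖w‖ = 1) ∧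
      ∀ v : E, ‖v‖ = 1 → ∃ w ∈ T, 3 / 4 ≤ ‖inner ℂ w v‖ ^ 2 := by
  classical
  let _ : NormedSpace ℝ E := NormedSpace.complexToReal
  have : FiniteDimensional ℝ E := FiniteDimensional.complexToReal E
  -- A maximal 1-separated subset of the sphere of radius 2: separated sets there have at most `5 ^
  -- k` points in real dimension `k`, and `k` is twice the complex dimension.
  let Sep : Finset E → Prop := fun s =>
    (∀ c ∈ s, ‖c‖ = 2) ∧ ∀ c ∈ s, ∀ d ∈ s, c ≠ d → 1 ≤ ‖c - d‖
  have hbound : ∀ s, Sep s → s.card ≤ 25 ^ Module.finrank ℂ E := by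
    intro s hs
    have h := Besicovitch.card_le_of_separated s (fun c hc => (hs.1 c hc).le) hs.2
    rwa [finrank_real_of_complex, pow_mul] at h
  obtain ⟨s, hs, hmax⟩ : ∃ s, Sep s ∧ ∀ t, Sep t → t.card ≤ s.card := by
    let P : ℕ → Prop := fun k => ∃ s, Sep s ∧ s.card = k
    obtain ⟨s, hs, hc⟩ : P (Nat.findGreatest P (25 ^ Module.finrank ℂ E)) :=
      Nat.findGreatest_spec (P := P) (Nat.zero_le _) ⟨∅, ⟨by simp, by simp⟩, rfl⟩
    exact ⟨s, hs, fun t ht => hc ▸ Nat.le_findGreatest (hbound t ht) ⟨t, ht, rfl⟩⟩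
  refine ⟨s.image fun x => (1 / 2 : ℂ) • x, Finset.card_image_le.trans (hbound s hs), ?_, ?_⟩
  · intro w hw
    obtain ⟨c, hc, rfl⟩ := Finset.mem_image.1 hw
    rw [norm_smul, hs.1 c hc]; norm_num
  · intro v hv
    have hv2 : ‖(2 : ℂ) • v‖ = 2 := by rw [norm_smul, hv]; norm_num
    obtain ⟨c, hc, hcv⟩ : ∃ c ∈ s, ‖c - (2 : ℂ) • v‖ < 1 := by
      by_contra! hfar
      have hnot : (2 : ℂ) • v ∉ s := by
        intro h
        have := hfar _ h
        rw [sub_self, norm_zero] at this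
        linarith
      have hsep : Sep (insert ((2 : ℂ) • v) s) := by
        refine ⟨fun c hc => ?_, fun c hc d hd hcd => ?_⟩
        · rcases Finset.mem_insert.1 hc with rfl | hc
          · exact hv2
          · exact hs.1 c hc
        · rcases Finset.mem_insert.1 hc with rfl | hc <;>
            rcases Finset.mem_insert.1 hd with rfl | hd
          · exact absurd rfl hcd
          · rw [norm_sub_rev]; exact hfar d hd
          · exact hfar c hc
          · exact hs.2 c hc d hd hcd
      have := hmax _ hsep
      rw [Finset.card_insert_of_notMem hnot] at this
      omega
    refine ⟨(1 / 2 : ℂ) • c, Finset.mem_image_of_mem _ hc, ?_⟩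
    have h1 := norm_sub_sq (𝕜 := ℂ) c ((2 : ℂ) • v)
    rw [hs.1 c hc, hv2, inner_smul_right] at h1
    have h2 : ‖c - (2 : ℂ) • v‖ ^ 2 < 1 := by
      have := norm_nonneg (c - (2 : ℂ) • v)
      nlinarith
    have h3 : RCLike.re ((2 : ℂ) * inner ℂ c v) = 2 * (inner ℂ c v : ℂ).re := by simp
    rw [h3] at h1
    have h4 : (inner ℂ c v : ℂ).re ≤ ‖inner ℂ c v‖ := Complex.re_le_norm _
    have h5 : ‖inner ℂ ((1 / 2 : ℂ) • c) v‖ = ‖inner ℂ c v‖ / 2 := by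
      rw [inner_smul_left, norm_mul]; simp; ring
    rw [h5]
    -- From `4 - 4 * Re ⟨c, v⟩ + 4 < 1`. After halving `c` the overlap is at least `7 / 8`, whose
    -- square exceeds `3 / 4`.
    have h6 : 7 / 4 ≤ ‖inner ℂ c v‖ := by linarith
    nlinarith

theorem sum_norm_sq_eq {n : ℕ} (v : Bits n → ℂ) :
    star v ⬝ᵥ v = ((∑ x, ‖v x‖ ^ 2 : ℝ) : ℂ) := by
  simp [dotProduct, Complex.conj_mul']

theorem exists_bits_net (n : ℕ) : ∃ T : Finset (Bits n → ℂ), T.card ≤ 25 ^ 2 ^ n ∧ T.Nonempty ∧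
    (∀ w ∈ T, star w ⬝ᵥ w = 1) ∧
    ∀ v : Bits n → ℂ, star v ⬝ᵥ v = 1 → ∃ w ∈ T, 3 / 4 ≤ ‖star w ⬝ᵥ v‖ ^ 2 := by
  classical
  obtain ⟨T, hT, h1, h2⟩ := exists_unit_net (EuclideanSpace ℂ (Bits n))
  have hcov : ∀ v : Bits n → ℂ, star v ⬝ᵥ v = 1 →
      ∃ w ∈ T.image WithLp.ofLp, 3 / 4 ≤ ‖star w ⬝ᵥ v‖ ^ 2 := by
    intro v hv
    obtain ⟨w, hw, h⟩ := h2 (WithLp.toLp 2 v) (by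
      rw [EuclideanSpace.norm_eq, Real.sqrt_eq_one]
      rw [sum_norm_sq_eq] at hv
      exact_mod_cast hv)
    refine ⟨w.ofLp, Finset.mem_image_of_mem _ hw, ?_⟩
    rwa [EuclideanSpace.inner_eq_star_dotProduct, dotProduct_comm] at h
  refine ⟨T.image WithLp.ofLp, Finset.card_image_le.trans ?_, ?_, ?_, hcov⟩
  · simpa using hT
  · obtain ⟨w, hw, -⟩ := hcov (Pi.single 0 1) (by simp)
    exact ⟨w, hw⟩
  · intro w hw
    obtain ⟨c, hc, rfl⟩ := Finset.mem_image.1 hw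
    have := h1 c hc
    rw [EuclideanSpace.norm_eq, Real.sqrt_eq_one] at this
    rw [sum_norm_sq_eq, this]; simp

/-! ### Trace inequalities for Hermitian and positive semidefinite matrices -/

section Hermitian

variable {ι : Type*} [Fintype ι]

theorem Matrix.IsHermitian.trace_mul_self_re {A : Matrix ι ι ℂ} (hA : A.IsHermitian) :
    (A * A).trace.re = ∑ x, ∑ y, ‖A x y‖ ^ 2 := by
  simp only [Matrix.trace, Matrix.diag_apply, Matrix.mul_apply, Complex.re_sum]
  refine Finset.sum_congr rfl fun x _ => Finset.sum_congr rfl fun y _ => ?_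
  rw [← hA.apply y x, ← Complex.normSq_eq_norm_sq]
  change (A x y * (starRingEnd ℂ) (A x y)).re = _
  rw [Complex.mul_conj, Complex.ofReal_re]

theorem Matrix.IsHermitian.trace_mul_self_nonneg {A : Matrix ι ι ℂ} (hA : A.IsHermitian) :
    0 ≤ (A * A).trace.re := by
  rw [hA.trace_mul_self_re]; positivity

/-- The Cauchy-Schwarz inequality for the Frobenius inner product. -/
theorem Matrix.IsHermitian.trace_mul_sq_le {A B : Matrix ι ι ℂ} (hA : A.IsHermitian)
    (hB : B.IsHermitian) :
    (A * B).trace.re ^ 2 ≤ (A * A).trace.re * (B * B).trace.re := by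
  rw [hA.trace_mul_self_re, hB.trace_mul_self_re,
    ← Finset.univ.sum_product' Finset.univ (fun x y => ‖A x y‖ ^ 2),
    ← Finset.univ.sum_product' Finset.univ (fun x y => ‖B x y‖ ^ 2)]
  refine le_trans ?_ (Finset.sum_mul_sq_le_sq_mul_sq _ _ _)
  rw [sq_le_sq, abs_of_nonneg (a := ∑ p ∈ _, _) (by positivity)]
  refine (Complex.abs_re_le_norm _).trans ?_
  rw [Matrix.trace, Finset.univ.sum_product' Finset.univ (fun x y => ‖A x y‖ * ‖B x y‖)]
  refine (norm_sum_le _ _).trans (Finset.sum_le_sum fun x _ => ?_)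
  rw [Matrix.diag_apply, Matrix.mul_apply]
  refine (norm_sum_le _ _).trans (Finset.sum_le_sum fun y _ => ?_)
  rw [norm_mul, ← hB.apply y x, norm_star]

open scoped MatrixOrder in
theorem Matrix.PosSemidef.trace_mul_nonneg {P Q : Matrix ι ι ℂ} (hP : P.PosSemidef)
    (hQ : Q.PosSemidef) : 0 ≤ (P * Q).trace.re := by
  classical
  obtain ⟨B, rfl⟩ := CStarAlgebra.nonneg_iff_eq_star_mul_self.mp hP.nonneg
  rw [Matrix.star_eq_conjTranspose, mul_assoc, Matrix.trace_mul_comm]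
  exact (Complex.le_def.1 (hQ.mul_mul_conjTranspose_same B).trace_nonneg).1

theorem Matrix.IsHermitian.posSemidef_mul_self {A : Matrix ι ι ℂ} (hA : A.IsHermitian) :
    (A * A).PosSemidef := by
  have := Matrix.posSemidef_conjTranspose_mul_self A
  rwa [hA.eq] at this

theorem Matrix.PosSemidef.trace_re_nonneg {P : Matrix ι ι ℂ} (hP : P.PosSemidef) :
    0 ≤ P.trace.re := (Complex.le_def.1 hP.trace_nonneg).1

variable [DecidableEq ι]

/-- Diagonal entries in the eigenbasis. -/
theorem Matrix.IsHermitian.star_eigenvectorUnitary_mul_mul {A : Matrix ι ι ℂ}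
    (hA : A.IsHermitian) :
    star (hA.eigenvectorUnitary : Matrix ι ι ℂ) * A * (hA.eigenvectorUnitary : Matrix ι ι ℂ) =
      Matrix.diagonal fun i => (hA.eigenvalues i : ℂ) := by
  have h := hA.conjStarAlgAut_star_eigenvectorUnitary
  rw [Unitary.conjStarAlgAut_star_apply] at h
  exact h

theorem Matrix.IsHermitian.trace_mul_self_eq_sum {A : Matrix ι ι ℂ} (hA : A.IsHermitian) :
    (A * A).trace.re = ∑ i, hA.eigenvalues i ^ 2 := by
  have hr := Matrix.mem_unitaryGroup_iff.1 hA.eigenvectorUnitary.2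
  set U : Matrix ι ι ℂ := (hA.eigenvectorUnitary : Matrix ι ι ℂ) with hU
  have h : (star U * A * U) * (star U * A * U) = star U * (A * A) * U := by
    simp only [mul_assoc]
    rw [← mul_assoc U (star U), hr, one_mul]
  have h2 : (star U * (A * A) * U).trace = (A * A).trace := by
    rw [mul_assoc, Matrix.trace_mul_comm, mul_assoc, hr, mul_one]
  rw [← h2, ← h, hA.star_eigenvectorUnitary_mul_mul, Matrix.diagonal_mul_diagonal,
    Matrix.trace_diagonal, Complex.re_sum]
  refine Finset.sum_congr rfl fun i _ => ?_
  rw [← Complex.ofReal_mul, Complex.ofReal_re, sq]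

theorem Matrix.IsHermitian.trace_re_eq_sum {A : Matrix ι ι ℂ} (hA : A.IsHermitian) :
    A.trace.re = ∑ i, hA.eigenvalues i := by
  rw [hA.trace_eq_sum_eigenvalues]; simp

theorem Matrix.PosSemidef.trace_mul_self_le {P : Matrix ι ι ℂ} (hP : P.PosSemidef) :
    (P * P).trace.re ≤ P.trace.re ^ 2 := by
  rw [hP.1.trace_mul_self_eq_sum, hP.1.trace_re_eq_sum]
  exact Finset.sum_sq_le_sq_sum_of_nonneg fun i _ => hP.eigenvalues_nonneg i

/-- Cauchy-Schwarz, combined with the fact that for nonnegative eigenvalues the sum of squares is at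
most the square of the sum. -/
theorem Matrix.PosSemidef.trace_mul_le {P Q : Matrix ι ι ℂ} (hP : P.PosSemidef)
    (hQ : Q.PosSemidef) : (P * Q).trace.re ≤ P.trace.re * Q.trace.re := by
  refine abs_le_of_sq_le_sq' ?_ (mul_nonneg hP.trace_re_nonneg hQ.trace_re_nonneg) |>.2
  refine (hP.1.trace_mul_sq_le hQ.1).trans ?_
  rw [mul_pow]
  exact mul_le_mul hP.trace_mul_self_le hQ.trace_mul_self_le hQ.1.trace_mul_self_nonneg
    (sq_nonneg _)

end Hermitian

/-! ### From quadratic forms on a net to the Frobenius distance of states -/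

section States

variable {n : ℕ}

theorem QState.sub_isHermitian (ρ σ : QState n) : (ρ.mat - σ.mat).IsHermitian :=
  ρ.posSemidef.1.sub σ.posSemidef.1

theorem QState.trace_sub_sq_le_two (ρ σ : QState n) :
    ((ρ.mat - σ.mat) * (ρ.mat - σ.mat)).trace.re ≤ 2 := by
  have h1 := ρ.posSemidef.trace_mul_self_le
  have h2 := σ.posSemidef.trace_mul_self_le
  have h3 := ρ.posSemidef.trace_mul_nonneg σ.posSemidef
  have h4 := σ.posSemidef.trace_mul_nonneg ρ.posSemidef
  rw [ρ.trace_eq_one] at h1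
  rw [σ.trace_eq_one] at h2
  simp only [sub_mul, mul_sub, Matrix.trace_sub, Complex.sub_re]
  norm_num at h1 h2
  linarith

theorem sq_norm_star_mulVec (U : QMat n) (hU : U * star U = 1) (w : Bits n → ℂ) :
    star ((star U).mulVec w) ⬝ᵥ (star U).mulVec w = star w ⬝ᵥ w := by
  rw [Matrix.star_mulVec, Matrix.star_eq_conjTranspose, Matrix.conjTranspose_conjTranspose,
    Matrix.dotProduct_mulVec, Matrix.vecMul_vecMul, ← Matrix.star_eq_conjTranspose, hU,
    Matrix.vecMul_one]

theorem quadForm_eq_sum {A : QMat n} (hA : A.IsHermitian) (w : Bits n → ℂ) :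
    star w ⬝ᵥ A.mulVec w = ((∑ i, hA.eigenvalues i *
      ‖(star (hA.eigenvectorUnitary : QMat n)).mulVec w i‖ ^ 2 : ℝ) : ℂ) := by
  have hr := Matrix.mem_unitaryGroup_iff.1 hA.eigenvectorUnitary.2
  have hd := hA.star_eigenvectorUnitary_mul_mul
  set U : QMat n := (hA.eigenvectorUnitary : QMat n) with hU
  have h : A = U * (Matrix.diagonal fun i => (hA.eigenvalues i : ℂ)) * star U := by
    rw [← hd]
    simp only [mul_assoc]
    rw [hr, mul_one, ← mul_assoc, hr, one_mul]
  have h2 : star w ⬝ᵥ A.mulVec w = star ((star U).mulVec w) ⬝ᵥ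
      (Matrix.diagonal fun i => (hA.eigenvalues i : ℂ)).mulVec ((star U).mulVec w) := by
    conv_lhs => rw [h]
    rw [Matrix.star_mulVec, Matrix.star_eq_conjTranspose, Matrix.conjTranspose_conjTranspose,
      ← Matrix.dotProduct_mulVec, Matrix.mulVec_mulVec, Matrix.mulVec_mulVec, mul_assoc]
  rw [h2]
  simp only [dotProduct, Matrix.mulVec_diagonal, Pi.star_apply, RCLike.star_def]
  push_cast
  refine Finset.sum_congr rfl fun i _ => ?_
  rw [mul_left_comm, Complex.conj_mul']

/-- On a net of unit vectors with large overlaps, the quadratic form of a Hermitian matrix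
controls all eigenvalues. -/
theorem eigenvalues_le_of_net {A : QMat n} (hA : A.IsHermitian) {T : Finset (Bits n → ℂ)}
    (hT : ∀ w ∈ T, star w ⬝ᵥ w = 1)
    (hcov : ∀ v : Bits n → ℂ, star v ⬝ᵥ v = 1 → ∃ w ∈ T, 3 / 4 ≤ ‖star w ⬝ᵥ v‖ ^ 2)
    {τ : ℝ} (h : ∀ w ∈ T, |(star w ⬝ᵥ A.mulVec w).re| ≤ τ) (i : Bits n) :
    |hA.eigenvalues i| ≤ 2 * τ := by
  -- For an eigenvalue of largest modulus and a net vector with weight `a ≥ 3 / 4` on its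
  -- eigenvector, the other eigenvalues contribute at most `|λ| (1 - a)`. The quadratic form is thus
  -- at least `|λ| (2 a - 1) ≥ |λ| / 2` in modulus.
  obtain ⟨m, -, hm⟩ := Finset.exists_max_image Finset.univ (fun i => |hA.eigenvalues i|)
    ⟨i, Finset.mem_univ i⟩
  refine (hm i (Finset.mem_univ i)).trans ?_
  have hr := Matrix.mem_unitaryGroup_iff.1 hA.eigenvectorUnitary.2
  have hl := Matrix.mem_unitaryGroup_iff'.1 hA.eigenvectorUnitary.2
  have hq := quadForm_eq_sum hA
  set U : QMat n := (hA.eigenvectorUnitary : QMat n) with hU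
  obtain ⟨w, hw, hov⟩ := hcov (U.mulVec (Pi.single m 1)) (by
    have := sq_norm_star_mulVec (star U) (by rwa [star_star]) (Pi.single m 1)
    rw [star_star] at this
    rw [this]; simp)
  have hwm := h w hw
  have hnorm : ∑ j, ‖(star U).mulVec w j‖ ^ 2 = 1 := by
    have := sq_norm_star_mulVec U hr w
    rw [hT w hw, sum_norm_sq_eq] at this
    exact_mod_cast this
  have hcoef : ‖(star U).mulVec w m‖ = ‖star w ⬝ᵥ U.mulVec (Pi.single m 1)‖ := by
    rw [← norm_star ((star U).mulVec w m), Matrix.dotProduct_mulVec,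
      Matrix.star_eq_conjTranspose]
    congr 1
    have := congrFun (Matrix.star_mulVec U.conjTranspose w) m
    rw [Pi.star_apply, Matrix.conjTranspose_conjTranspose] at this
    rw [this]; simp
  rw [← hcoef] at hov
  rw [hq, Complex.ofReal_re, ← Finset.add_sum_erase _ _ (Finset.mem_univ m)] at hwm
  rw [← Finset.add_sum_erase _ _ (Finset.mem_univ m)] at hnorm
  set a := ‖(star U).mulVec w m‖ ^ 2 with ha
  have hrest : |∑ j ∈ Finset.univ.erase m, hA.eigenvalues j * ‖(star U).mulVec w j‖ ^ 2| ≤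
      |hA.eigenvalues m| * (1 - a) := by
    rw [show 1 - a = ∑ j ∈ Finset.univ.erase m, ‖(star U).mulVec w j‖ ^ 2 by linarith,
      Finset.mul_sum]
    refine (Finset.abs_sum_le_sum_abs _ _).trans (Finset.sum_le_sum fun j _ => ?_)
    rw [abs_mul, abs_of_nonneg (sq_nonneg ‖(star U).mulVec w j‖)]
    exact mul_le_mul_of_nonneg_right (hm j (Finset.mem_univ j)) (sq_nonneg _)
  have hmain : |hA.eigenvalues m * a| = |hA.eigenvalues m| * a := by
    rw [abs_mul, abs_of_nonneg (by positivity : 0 ≤ a)]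
  have htri : |hA.eigenvalues m * a| ≤
      |hA.eigenvalues m * a + ∑ j ∈ Finset.univ.erase m,
        hA.eigenvalues j * ‖(star U).mulVec w j‖ ^ 2| +
      |∑ j ∈ Finset.univ.erase m, hA.eigenvalues j * ‖(star U).mulVec w j‖ ^ 2| := by
    have := abs_sub (hA.eigenvalues m * a + ∑ j ∈ Finset.univ.erase m,
        hA.eigenvalues j * ‖(star U).mulVec w j‖ ^ 2)
      (∑ j ∈ Finset.univ.erase m, hA.eigenvalues j * ‖(star U).mulVec w j‖ ^ 2)
    rwa [add_sub_cancel_right] at this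
  have h0 := abs_nonneg (hA.eigenvalues m)
  nlinarith

/-- If all eigenvalues of a difference of states are small, then so is its Frobenius norm. -/
theorem QState.trace_sub_sq_le (ρ σ : QState n) {t : ℝ}
    (h : ∀ i, |(ρ.sub_isHermitian σ).eigenvalues i| ≤ t) :
    ((ρ.mat - σ.mat) * (ρ.mat - σ.mat)).trace.re ≤ min (2 * t) (2 ^ n * t ^ 2) := by
  set hA := ρ.sub_isHermitian σ with hAdef
  rw [hA.trace_mul_self_eq_sum]
  apply le_min
  · have hr := Matrix.mem_unitaryGroup_iff.1 hA.eigenvectorUnitary.2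
    have hd := hA.star_eigenvectorUnitary_mul_mul
    set U : QMat n := (hA.eigenvectorUnitary : QMat n) with hU
    have hpsd : ∀ τ : QState n, (star U * τ.mat * U).PosSemidef := fun τ =>
      τ.posSemidef.conjTranspose_mul_mul_same U
    have htr : ∀ τ : QState n, ∑ i, ((star U * τ.mat * U) i i).re = 1 := by
      intro τ
      have : (star U * τ.mat * U).trace = 1 := by
        rw [mul_assoc, Matrix.trace_mul_comm, mul_assoc, hr, mul_one, τ.trace_eq_one]
      have h2 := congrArg Complex.re this
      simpa [Matrix.trace] using h2
    have hnn : ∀ (τ : QState n) i, 0 ≤ ((star U * τ.mat * U) i i).re := fun τ i =>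
      (Complex.le_def.1 ((hpsd τ).diag_nonneg (i := i))).1
    have hev : ∀ i, hA.eigenvalues i =
        ((star U * ρ.mat * U) i i).re - ((star U * σ.mat * U) i i).re := by
      intro i
      have := congrArg Complex.re (congrFun (congrFun hd i) i)
      rw [mul_sub, sub_mul, Matrix.sub_apply, Complex.sub_re, Matrix.diagonal_apply_eq,
        Complex.ofReal_re] at this
      exact this.symm
    -- One factor is bounded by `t`, the other by the sum of the diagonal entries of both states in
    -- the eigenbasis of the difference; these entries add up to 2.
    have hbd : ∀ i, hA.eigenvalues i ^ 2 ≤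
        t * (((star U * ρ.mat * U) i i).re + ((star U * σ.mat * U) i i).re) := by
      intro i
      rw [← sq_abs, sq]
      have h1 : |hA.eigenvalues i| ≤
          ((star U * ρ.mat * U) i i).re + ((star U * σ.mat * U) i i).re := by
        rw [hev, abs_le]
        constructor <;> linarith [hnn ρ i, hnn σ i]
      exact mul_le_mul (h i) h1 (abs_nonneg _) ((abs_nonneg _).trans (h i))
    refine (Finset.sum_le_sum fun i _ => hbd i).trans ?_
    rw [← Finset.mul_sum, Finset.sum_add_distrib, htr, htr]
    linarith
  · have : ∀ i ∈ (Finset.univ : Finset (Bits n)), hA.eigenvalues i ^ 2 ≤ t ^ 2 := fun i _ =>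
      sq_le_sq' (abs_le.1 (h i)).1 (abs_le.1 (h i)).2
    refine (Finset.sum_le_card_nsmul _ _ _ this).trans ?_
    simp

end States

/-! ### Median-of-means estimation -/

section MedianOfMeans

open ProbabilityTheory

/-- Chebyshev's inequality for the mean of `b` independent copies. -/
theorem pi_mean_deviation {S : Type*} [MeasurableSpace S] (μ : Measure S)
    [IsProbabilityMeasure μ] {f : S → ℝ} (hf : MemLp f 2 μ) {b : ℕ} (hb : 0 < b) {t : ℝ}
    (ht : 0 < t) :
    (Measure.pi fun _ : Fin b => μ).real {x | t ≤ |(∑ j, f (x j)) / b - ∫ s, f s ∂μ|} ≤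
      variance f μ / (b * t ^ 2) := by
  have hb' : (0 : ℝ) < b := by exact_mod_cast hb
  set ν := Measure.pi fun _ : Fin b => μ
  have hmp : ∀ j : Fin b, MeasurePreserving (fun x : Fin b → S => x j) ν μ := fun j =>
    measurePreserving_eval (fun _ : Fin b => μ) j
  have hLp : ∀ j : Fin b, MemLp (fun x : Fin b → S => f (x j)) 2 ν := fun j =>
    hf.comp_measurePreserving (hmp j)
  have hsum : MemLp (∑ j : Fin b, fun x : Fin b → S => f (x j)) 2 ν :=
    memLp_finsetSum' _ fun j _ => hLp j
  have hint : ∀ j : Fin b, ∫ x, f (x j) ∂ν = ∫ s, f s ∂μ := by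
    intro j
    rw [← (hmp j).map_eq, integral_map (hmp j).measurable.aemeasurable]
    rw [(hmp j).map_eq]; exact hf.aestronglyMeasurable
  have hmean : ∫ x, (∑ j : Fin b, fun x : Fin b → S => f (x j)) x ∂ν = b * ∫ s, f s ∂μ := by
    simp only [Finset.sum_apply]
    rw [integral_finsetSum _ fun j _ => (hLp j).integrable (by norm_num)]
    simp [hint]
  have hvar : variance (∑ j : Fin b, fun x : Fin b → S => f (x j)) ν = b * variance f μ := by
    rw [variance_sum_pi (μ := fun _ : Fin b => μ) (X := fun _ => f) fun _ => hf]
    simp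
  have hcheb := meas_ge_le_variance_div_sq hsum (c := b * t) (by positivity)
  have hset : {x : Fin b → S | t ≤ |(∑ j, f (x j)) / b - ∫ s, f s ∂μ|} =
      {x | b * t ≤ |(∑ j : Fin b, fun x : Fin b → S => f (x j)) x -
        ∫ x, (∑ j : Fin b, fun x : Fin b → S => f (x j)) x ∂ν|} := by
    ext x
    rw [Set.mem_ofPred_eq, Set.mem_ofPred_eq, hmean, Finset.sum_apply]
    have : (∑ j, f (x j)) - b * ∫ s, f s ∂μ = b * ((∑ j, f (x j)) / b - ∫ s, f s ∂μ) := by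
      field_simp
    rw [this, abs_mul, abs_of_pos hb', mul_le_mul_iff_right₀ hb']
  rw [hset, measureReal_def]
  refine (ENNReal.toReal_mono ENNReal.ofReal_ne_top hcheb).trans ?_
  rw [hvar, ENNReal.toReal_ofReal (by have := variance_nonneg f μ; positivity)]
  apply le_of_eq
  field_simp

/-- It is exponentially unlikely that half of `K` independent events of small probability occur. -/
theorem pi_half_fail {T : Type*} [MeasurableSpace T] (ν : Measure T) [IsProbabilityMeasure ν]
    {A : Set T} [DecidablePred (· ∈ A)] (hA : MeasurableSet A) (hp : ν.real A ≤ 1 / 16) (K : ℕ) :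
    (Measure.pi fun _ : Fin K => ν).real {y | K ≤ 2 * (Finset.univ.filter fun k => y k ∈ A).card} ≤
      (1 / 2) ^ K := by
  -- Exponential Markov inequality with weight 16 per failure: the product over the `K` copies has
  -- mean at most `2 ^ K`, while at least `K / 2` failures make it at least `16 ^ (K / 2) = 4 ^ K`.
  have hint : ∫ x, A.indicator (fun _ => (15 : ℝ)) x + 1 ∂ν ≤ 2 := by
    rw [integral_add ((integrable_const _).indicator hA) (integrable_const _),
      integral_indicator_const _ hA]
    simp only [smul_eq_mul, integral_const, probReal_univ]
    linarith
  have hint0 : 0 ≤ ∫ x, A.indicator (fun _ => (15 : ℝ)) x + 1 ∂ν :=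
    integral_nonneg fun x => add_nonneg (Set.indicator_nonneg (fun _ _ => by norm_num) _) zero_le_one
  have hval : ∀ y : Fin K → T, ∏ k, (A.indicator (fun _ => (15 : ℝ)) (y k) + 1) =
      16 ^ (Finset.univ.filter fun k => y k ∈ A).card := by
    intro y
    have : ∀ k, A.indicator (fun _ => (15 : ℝ)) (y k) + 1 = if y k ∈ A then 16 else 1 := by
      intro k
      by_cases h : y k ∈ A
      · rw [Set.indicator_of_mem h, if_pos h]; norm_num
      · rw [Set.indicator_of_notMem h, if_neg h]; norm_num
    simp only [this]
    rw [← Finset.prod_filter, Finset.prod_const]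
  have hI := integral_fintype_prod_eq_prod (μ := fun _ : Fin K => ν)
    (fun (_ : Fin K) (x : T) => A.indicator (fun _ => (15 : ℝ)) x + 1)
  have hintg : Integrable (fun y : Fin K → T => ∏ k, (A.indicator (fun _ => (15 : ℝ)) (y k) + 1))
      (Measure.pi fun _ : Fin K => ν) :=
    Integrable.fintype_prod (f := fun (_ : Fin K) (x : T) => A.indicator (fun _ => (15 : ℝ)) x + 1)
      fun _ => ((integrable_const _).indicator hA).add (integrable_const _)
  have hm := mul_meas_ge_le_integral_of_nonneg
    (ae_of_all _ fun y => Finset.prod_nonneg fun k _ =>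
      add_nonneg (Set.indicator_nonneg (fun _ _ => by norm_num) _) zero_le_one) hintg ((4 : ℝ) ^ K)
  rw [hI, Finset.prod_const, Finset.card_univ, Fintype.card_fin] at hm
  have hsub : {y : Fin K → T | K ≤ 2 * (Finset.univ.filter fun k => y k ∈ A).card} ⊆
      {y | (4 : ℝ) ^ K ≤ ∏ k, (A.indicator (fun _ => (15 : ℝ)) (y k) + 1)} := by
    intro y hy
    rw [Set.mem_ofPred_eq] at hy ⊢
    rw [hval, show (16 : ℝ) = 4 ^ 2 by norm_num, ← pow_mul]
    exact pow_le_pow_right₀ (by norm_num) hy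
  refine (measureReal_mono hsub).trans ?_
  have h4 : (0 : ℝ) < 4 ^ K := by positivity
  rw [← mul_le_mul_iff_right₀ h4, ← mul_pow]
  refine hm.trans ?_
  norm_num
  exact pow_le_pow_left₀ hint0 hint K

/-- Regrouping `K * b` independent samples into `K` batches of size `b`. -/
theorem pi_map_batches {S : Type*} [MeasurableSpace S] [MeasurableSingletonClass S] [Finite S]
    (μ : Measure S) [IsProbabilityMeasure μ] (K b : ℕ) :
    (Measure.pi fun _ : Fin (K * b) => μ).map (fun s k j => s (finProdFinEquiv (k, j))) =
      Measure.pi fun _ : Fin K => Measure.pi fun _ : Fin b => μ := by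
  have hmeas : Measurable fun (s : Fin (K * b) → S) (k : Fin K) (j : Fin b) =>
    s (finProdFinEquiv (k, j)) := by fun_prop
  apply Measure.ext_of_singleton
  intro y
  rw [Measure.map_apply hmeas (measurableSet_singleton _)]
  have : (fun (s : Fin (K * b) → S) (k : Fin K) (j : Fin b) => s (finProdFinEquiv (k, j))) ⁻¹' {y} =
      {fun i => y (finProdFinEquiv.symm i).1 (finProdFinEquiv.symm i).2} := by
    ext s
    simp only [Set.mem_preimage, Set.mem_singleton_iff]
    constructor
    · rintro rfl; funext i
      simp only [Prod.mk.eta, Equiv.apply_symm_apply]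
    · rintro rfl; funext k j
      simp only [Equiv.symm_apply_apply]
  rw [this, Measure.pi_singleton, Measure.pi_singleton]
  simp only [Measure.pi_singleton]
  rw [← Fintype.prod_prod_type' fun k j => μ {y k j}]
  exact Equiv.prod_comp finProdFinEquiv.symm fun p => μ {y p.1 p.2}

/-- A value that is `ε`-close to more than half of the numbers `v k`, if there is one. -/
noncomputable def majorityValue {K : ℕ} (ε : ℝ) (v : Fin K → ℝ) : ℝ :=
  open Classical in
  if h : ∃ x, K < 2 * (Finset.univ.filter fun k => |v k - x| < ε).card then h.choose else 0

theorem majorityValue_close {K : ℕ} {ε : ℝ} {v : Fin K → ℝ} {x : ℝ}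
    (h : K < 2 * (Finset.univ.filter fun k => |v k - x| < ε).card) :
    |majorityValue ε v - x| ≤ 2 * ε := by
  classical
  have hex : ∃ x, K < 2 * (Finset.univ.filter fun k => |v k - x| < ε).card := ⟨x, h⟩
  have hspec := hex.choose_spec
  have he : majorityValue ε v = hex.choose := by
    rw [majorityValue, dif_pos]
  rw [he]
  set z := hex.choose
  -- Two strict majorities share an index, so the chosen value and `x` are both close to a common `v
  -- k`. No property of the median beyond this is needed.
  have : ∃ k, k ∈ (Finset.univ.filter fun k => |v k - x| < ε) ∩
      (Finset.univ.filter fun k => |v k - z| < ε) := by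
    by_contra! hno
    have hd : Disjoint (Finset.univ.filter fun k => |v k - x| < ε)
        (Finset.univ.filter fun k => |v k - z| < ε) :=
      Finset.disjoint_iff_inter_eq_empty.2 (Finset.eq_empty_of_forall_notMem hno)
    have hc := Finset.card_union_of_disjoint hd
    have hle := Finset.card_le_univ ((Finset.univ.filter fun k => |v k - x| < ε) ∪
      (Finset.univ.filter fun k => |v k - z| < ε))
    rw [Fintype.card_fin] at hle
    omega
  obtain ⟨k, hk⟩ := this
  rw [Finset.mem_inter, Finset.mem_filter, Finset.mem_filter] at hk
  have h1 := abs_lt.1 hk.1.2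
  have h2 := abs_lt.1 hk.2.2
  rw [abs_le]
  constructor <;> linarith

/-- The median-of-means estimator built from `K` batches of size `b`. -/
noncomputable def medianOfMeans {S : Type*} (f : S → ℝ) (ε : ℝ) (K b : ℕ)
    (s : Fin (K * b) → S) : ℝ :=
  majorityValue (ε / 2) fun k => (∑ j : Fin b, f (s (finProdFinEquiv (k, j)))) / b

/-- The majority rule doubles the tolerance, so batches are required to be accurate to `ε / 2`. The
factor 64 is `4 * 16`, which makes Chebyshev's bound for one batch at most `1 / 16`. -/
theorem medianOfMeans_fail {S : Type*} [MeasurableSpace S] [MeasurableSingletonClass S] [Finite S]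
    (μ : Measure S) [IsProbabilityMeasure μ] (f : S → ℝ) {ε : ℝ} (hε : 0 < ε) (K : ℕ) {b : ℕ}
    (hb : 0 < b) (hvar : variance f μ * 64 ≤ b * ε ^ 2) :
    (Measure.pi fun _ : Fin (K * b) => μ).real
      {s | ε < |medianOfMeans f ε K b s - ∫ x, f x ∂μ|} ≤ (1 / 2) ^ K := by
  classical
  set A : Set (Fin b → S) := {x | ε / 2 ≤ |(∑ j, f (x j)) / b - ∫ s, f s ∂μ|} with hA
  have hAm : MeasurableSet A := A.toFinite.measurableSet
  have hb' : (0 : ℝ) < b := by exact_mod_cast hb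
  have hfin : MemLp f 2 μ := MemLp.of_discrete
  have hp : (Measure.pi fun _ : Fin b => μ).real A ≤ 1 / 16 := by
    refine (pi_mean_deviation μ hfin hb (half_pos hε)).trans ?_
    rw [div_le_iff₀ (by positivity)]
    linarith
  have hmeas : Measurable fun (s : Fin (K * b) → S) (k : Fin K) (j : Fin b) =>
    s (finProdFinEquiv (k, j)) := by fun_prop
  have hhalf := pi_half_fail (Measure.pi fun _ : Fin b => μ) hAm hp K
  rw [← pi_map_batches, map_measureReal_apply hmeas (Set.toFinite _).measurableSet] at hhalf
  refine (measureReal_mono ?_).trans hhalf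
  intro s hs
  rw [Set.mem_ofPred_eq] at hs
  rw [Set.mem_preimage, Set.mem_ofPred_eq]
  by_contra! hlt
  apply absurd hs
  rw [not_lt]
  have hkey : K < 2 * (Finset.univ.filter fun k : Fin K =>
      |(∑ j : Fin b, f (s (finProdFinEquiv (k, j)))) / b - ∫ x, f x ∂μ| < ε / 2).card := by
    have hadd := Finset.card_filter_add_card_filter_not (s := (Finset.univ : Finset (Fin K)))
      (fun k => (fun j : Fin b => s (finProdFinEquiv (k, j))) ∈ A)
    rw [Finset.card_univ, Fintype.card_fin] at hadd
    have heq : (Finset.univ.filter fun k : Fin K =>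
        ¬ (fun j : Fin b => s (finProdFinEquiv (k, j))) ∈ A) = (Finset.univ.filter fun k : Fin K =>
        |(∑ j : Fin b, f (s (finProdFinEquiv (k, j)))) / b - ∫ x, f x ∂μ| < ε / 2) := by
      ext k
      simp [hA]
    rw [heq] at hadd
    omega
  have := majorityValue_close hkey
  rw [medianOfMeans]
  linarith

end MedianOfMeans

/-! ### Classical shadows: unbiasedness, variance and sample complexity -/

section Shadow

open ProbabilityTheory

variable {n : ℕ}

theorem Matrix.IsHermitian.ofReal_trace_mul_re {ι : Type*} [Fintype ι] {A B : Matrix ι ι ℂ}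
    (hA : A.IsHermitian) (hB : B.IsHermitian) : ((A * B).trace.re : ℂ) = (A * B).trace := by
  rw [← Complex.conj_eq_iff_re]
  have h := Matrix.trace_conjTranspose (A * B)
  rw [Matrix.conjTranspose_mul, hA.eq, hB.eq, Matrix.trace_mul_comm] at h
  exact h.symm

theorem stab_proj_isHermitian (s : StabState n) : s.proj.IsHermitian := stab_proj_star s

theorem exists_real_trace {A : QMat n} (hA : A.IsHermitian) :
    ∃ x : StabState n → ℝ, ∀ s, (s.proj * A).trace = x s :=
  ⟨_, fun s => ((stab_proj_isHermitian s).ofReal_trace_mul_re hA).symm⟩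

/-- The traceless part of a matrix. -/
noncomputable def tracelessPart (O : QMat n) : QMat n := O - (O.trace / 2 ^ n) • 1

theorem trace_tracelessPart (O : QMat n) : (tracelessPart O).trace = 0 := by
  have hD : (2 : ℂ) ^ n ≠ 0 := by positivity
  rw [tracelessPart, Matrix.trace_sub, Matrix.trace_smul, Matrix.trace_one]
  simp [hD]

theorem Matrix.IsHermitian.trace_conj {O : QMat n} (hO : O.IsHermitian) :
    (starRingEnd ℂ) O.trace = O.trace := by
  have h := Matrix.trace_conjTranspose O
  rw [hO.eq] at h
  exact h.symm

theorem tracelessPart_isHermitian {O : QMat n} (hO : O.IsHermitian) :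
    (tracelessPart O).IsHermitian := by
  refine hO.sub ?_
  rw [Matrix.IsHermitian, Matrix.conjTranspose_smul, Matrix.conjTranspose_one]
  congr 1
  simp [hO.trace_conj]

theorem trace_tracelessPart_sq_le {O : QMat n} (hO : O.IsHermitian) :
    (tracelessPart O * tracelessPart O).trace.re ≤ (O * O).trace.re := by
  have hD : (2 : ℂ) ^ n ≠ 0 := by positivity
  have hre : ((O.trace.re : ℝ) : ℂ) = O.trace := Complex.conj_eq_iff_re.1 hO.trace_conj
  have h : (tracelessPart O * tracelessPart O).trace =
      (O * O).trace - ((O.trace.re ^ 2 / 2 ^ n : ℝ) : ℂ) := by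
    push_cast
    rw [hre]
    simp only [tracelessPart, sub_mul, mul_sub, Matrix.smul_mul, Matrix.mul_smul, mul_one, one_mul,
      Matrix.trace_sub, Matrix.trace_smul, smul_eq_mul, Matrix.trace_one]
    simp
    field_simp
  rw [h, Complex.sub_re, Complex.ofReal_re]
  have : 0 ≤ O.trace.re ^ 2 / 2 ^ n := by positivity
  linarith

/-- The classical shadow estimator of `tr (O ρ)` from a single stabilizer measurement. -/
noncomputable def shadowEstimate (O : QMat n) (s : StabState n) : ℝ :=
  (2 ^ n + 1) * (s.proj * tracelessPart O).trace.re + O.trace.re / 2 ^ n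

theorem integral_stabPMF (ρ : QState n) (f : StabState n → ℝ) :
    ∫ s, f s ∂(stabPMF ρ).toMeasure = 2 ^ n / Fintype.card (StabState n) *
      ∑ s : StabState n, (s.proj * ρ.mat).trace.re * f s := by
  rw [PMF.integral_eq_sum, Finset.mul_sum]
  refine Finset.sum_congr rfl fun s _ => ?_
  rw [stabPMF, PMF.ofFintype_apply, ENNReal.toReal_ofReal (stabEffect_nonneg ρ s), stabEffect,
    Matrix.smul_mul, Matrix.trace_smul, smul_eq_mul, smul_eq_mul]
  have e : ((2 : ℂ) ^ n / Fintype.card (StabState n)) =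
      (((2 : ℝ) ^ n / Fintype.card (StabState n) : ℝ) : ℂ) := by push_cast; rfl
  rw [e, Complex.re_ofReal_mul, mul_assoc]

theorem card_stab_pos (n : ℕ) : (0 : ℝ) < Fintype.card (StabState n) := by
  exact_mod_cast Fintype.card_pos

/-- On traceless observables the measurement acts as multiplication by `1 / (D + 1)`, by the second
moment formula; the prefactor inverts this. -/
theorem integral_shadow_traceless (ρ : QState n) {O : QMat n} (hO : O.IsHermitian) :
    ∫ s, (2 ^ n + 1) * (s.proj * tracelessPart O).trace.re ∂(stabPMF ρ).toMeasure =
      (ρ.mat * tracelessPart O).trace.re := by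
  have h := stab_two_design ρ.mat (tracelessPart O) (trace_tracelessPart O)
  have hA := tracelessPart_isHermitian hO
  obtain ⟨x, hx⟩ := exists_real_trace ρ.posSemidef.1
  obtain ⟨y, hy⟩ := exists_real_trace hA
  obtain ⟨r, hr⟩ : ∃ r : ℝ, (ρ.mat * tracelessPart O).trace = r :=
    ⟨_, (ρ.posSemidef.1.ofReal_trace_mul_re hA).symm⟩
  simp only [hx, hy, hr] at h
  have h' : (2 : ℝ) ^ n * (2 ^ n + 1) * ∑ s : StabState n, x s * y s =
      Fintype.card (StabState n) * r := by exact_mod_cast h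
  have hc := card_stab_pos n
  rw [integral_stabPMF]
  simp only [hx, hy, hr, Complex.ofReal_re]
  rw [div_mul_eq_mul_div, div_eq_iff hc.ne', mul_comm _ (Fintype.card _ : ℝ), ← h',
    mul_assoc, Finset.mul_sum (a := (2 : ℝ) ^ n + 1)]
  congr 1
  exact Finset.sum_congr rfl fun s _ => by ring

theorem integral_shadow_traceless_sq (ρ : QState n) {O : QMat n} (hO : O.IsHermitian) :
    ∫ s, ((2 ^ n + 1) * (s.proj * tracelessPart O).trace.re) ^ 2 ∂(stabPMF ρ).toMeasure ≤
      3 * (O * O).trace.re := by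
  have h := stab_three_design ρ.mat (tracelessPart O) (trace_tracelessPart O)
  have hA := tracelessPart_isHermitian hO
  have hc := card_stab_pos n
  have h1 : (ρ.mat * (tracelessPart O * tracelessPart O)).trace.re ≤
      (tracelessPart O * tracelessPart O).trace.re := by
    have := ρ.posSemidef.trace_mul_le hA.posSemidef_mul_self
    rwa [ρ.trace_eq_one, Complex.one_re, one_mul] at this
  have h2 := trace_tracelessPart_sq_le hO
  have h3 := hA.trace_mul_self_nonneg
  obtain ⟨x, hx⟩ := exists_real_trace ρ.posSemidef.1
  obtain ⟨y, hy⟩ := exists_real_trace hA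
  obtain ⟨R, hR⟩ : ∃ r : ℝ, (ρ.mat * (tracelessPart O * tracelessPart O)).trace = r :=
    ⟨_, (ρ.posSemidef.1.ofReal_trace_mul_re hA.posSemidef_mul_self.1).symm⟩
  obtain ⟨T, hT⟩ : ∃ r : ℝ, (tracelessPart O * tracelessPart O).trace = r :=
    ⟨_, (hA.ofReal_trace_mul_re hA).symm⟩
  simp only [hx, hy, hR, hT, ρ.trace_eq_one, one_mul] at h
  rw [hR, hT, Complex.ofReal_re, Complex.ofReal_re] at h1
  rw [hT, Complex.ofReal_re] at h2 h3
  have h' : (2 : ℝ) ^ n * (2 ^ n + 1) * (2 ^ n + 2) * ∑ s : StabState n, x s * (y s * y s) =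
      Fintype.card (StabState n) * (2 * R + T) := by exact_mod_cast h
  have h4 : ∑ s : StabState n, x s * ((2 ^ n + 1) * y s) ^ 2 = (2 ^ n + 1) ^ 2 *
      ∑ s : StabState n, x s * (y s * y s) := by
    rw [Finset.mul_sum]
    exact Finset.sum_congr rfl fun s _ => by ring
  rw [integral_stabPMF]
  simp only [hx, hy, Complex.ofReal_re]
  rw [h4]
  set S := ∑ s : StabState n, x s * (y s * y s)
  have hD : (0 : ℝ) < 2 ^ n := by positivity
  -- The dimension nearly cancels, leaving `(D + 1) / (D + 2) ≤ 1`. What remains is `2 R + T` with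
  -- `R ≤ T`, hence the constant 3.
  have e : 2 ^ n / (Fintype.card (StabState n) : ℝ) * ((2 ^ n + 1) ^ 2 * S) =
      (2 ^ n + 1) / (2 ^ n + 2) * (2 * R + T) := by
    field_simp
    linear_combination h'
  rw [e, div_mul_eq_mul_div, div_le_iff₀ (by positivity)]
  nlinarith

theorem integral_shadowEstimate (ρ : QState n) {O : QMat n} (hO : O.IsHermitian) :
    ∫ s, shadowEstimate O s ∂(stabPMF ρ).toMeasure = (O * ρ.mat).trace.re := by
  have : Finite (StabState n) := Finite.of_fintype _
  have hre : ((O.trace.re : ℝ) : ℂ) = O.trace := Complex.conj_eq_iff_re.1 hO.trace_conj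
  simp only [shadowEstimate]
  rw [integral_add Integrable.of_finite Integrable.of_finite, integral_shadow_traceless ρ hO]
  have e : (ρ.mat * tracelessPart O).trace =
      (O * ρ.mat).trace - ((O.trace.re / 2 ^ n : ℝ) : ℂ) := by
    rw [tracelessPart, mul_sub, Matrix.trace_sub, Matrix.trace_mul_comm, Matrix.mul_smul, mul_one,
      Matrix.trace_smul, ρ.trace_eq_one]
    push_cast
    rw [hre]; simp
  rw [e, Complex.sub_re, Complex.ofReal_re]
  simp

theorem variance_shadowEstimate_le (ρ : QState n) {O : QMat n} (hO : O.IsHermitian) :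
    variance (shadowEstimate O) (stabPMF ρ).toMeasure ≤ 3 * (O * O).trace.re := by
  have : Finite (StabState n) := Finite.of_fintype _
  have hm : ∀ f : StabState n → ℝ, AEStronglyMeasurable f (stabPMF ρ).toMeasure := fun f =>
    (measurable_of_finite f).aestronglyMeasurable
  have h : variance (shadowEstimate O) (stabPMF ρ).toMeasure =
      variance (fun s => (2 ^ n + 1) * (s.proj * tracelessPart O).trace.re)
        (stabPMF ρ).toMeasure :=
    variance_add_const (hm _) _
  rw [h]
  refine (variance_le_expectation_sq (hm _)).trans ?_
  exact integral_shadow_traceless_sq ρ hO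

/-- Simultaneous estimation of a finite family of observables by median-of-means classical
shadows. -/
theorem exists_predict_family {ι : Type*} [Fintype ι] [Nonempty ι] (O : ι → QMat n)
    (hO : ∀ i, (O i).IsHermitian) {B ε δ : ℝ} (hB : ∀ i, (O i * O i).trace.re ≤ B) (hε : 0 < ε)
    (hεB : ε ^ 2 ≤ B) (hδ : 0 < δ) (hδ1 : δ ≤ 1) :
    ∃ N : ℕ, (N : ℝ) ≤ 400 * (B / ε ^ 2) * (Real.log (Fintype.card ι) + Real.log (2 / δ)) ∧
      ∃ predict : (Fin N → StabState n) → ι → ℝ, ∀ ρ : QState n,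
        1 - δ ≤ (stabLaw ρ N).real {s | ∀ i, |predict s i - (O i * ρ.mat).trace.re| ≤ ε} := by
  have : Finite (StabState n) := Finite.of_fintype _
  have hm : (1 : ℝ) ≤ (Fintype.card ι : ℝ) := by
    exact_mod_cast (Fintype.card_pos : 0 < Fintype.card ι)
  set m : ℝ := (Fintype.card ι : ℝ) with hmdef
  have hm0 : 0 < m := by linarith
  have hmδ : 1 ≤ m / δ := by rw [le_div_iff₀ hδ]; linarith
  have hr : 1 ≤ B / ε ^ 2 := by rw [le_div_iff₀ (by positivity)]; linarith
  -- The number of batches makes the union bound `m * 2 ^ (-K)` at most `δ`. The batch size uses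
  -- `192 = 3 * 64`, from the variance bound and the requirement of `medianOfMeans_fail`.
  set K := ⌈Real.logb 2 (m / δ)⌉₊ with hK
  set b := ⌈192 * (B / ε ^ 2)⌉₊ with hb
  have hb1 : 192 * (B / ε ^ 2) ≤ b := Nat.le_ceil _
  have hb0 : 0 < b := by
    have : (0 : ℝ) < b := by linarith
    exact_mod_cast this
  -- Rounding up is absorbed because `B / ε ^ 2 ≥ 1`.
  have hb2 : (b : ℝ) ≤ 193 * (B / ε ^ 2) := by
    have := Nat.ceil_lt_add_one (a := 192 * (B / ε ^ 2)) (by linarith)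
    linarith
  have hlog2 := Real.log_two_gt_d9
  have hK1 : (K : ℝ) ≤ 2 * (Real.log m + Real.log (2 / δ)) := by
    have h1 := Nat.ceil_lt_add_one (a := Real.logb 2 (m / δ)) (Real.logb_nonneg (by norm_num) hmδ)
    have h2 : Real.log m + Real.log (2 / δ) = Real.log (m / δ) + Real.log 2 := by
      rw [Real.log_div (by norm_num) hδ.ne', Real.log_div hm0.ne' hδ.ne']; ring
    have h3 : Real.logb 2 (m / δ) * Real.log 2 = Real.log (m / δ) := by
      rw [Real.logb, div_mul_cancel₀ _ (by linarith)]
    have h4 := Real.logb_nonneg (b := 2) (by norm_num) hmδ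
    rw [h2, ← h3]
    nlinarith
  have hKδ : m * (1 / 2) ^ K ≤ δ := by
    have h1 : Real.logb 2 (m / δ) ≤ K := Nat.le_ceil _
    rw [Real.logb_le_iff_le_rpow (by norm_num) (by positivity), Real.rpow_natCast,
      div_le_iff₀ hδ] at h1
    rw [one_div, inv_pow, ← div_eq_mul_inv, div_le_iff₀ (by positivity)]
    linarith
  refine ⟨K * b, ?_, fun s i => medianOfMeans (shadowEstimate (O i)) ε K b s, ?_⟩
  · have h0 : (0 : ℝ) ≤ K := Nat.cast_nonneg _
    push_cast
    calc (K : ℝ) * b ≤ (2 * (Real.log m + Real.log (2 / δ))) * (193 * (B / ε ^ 2)) :=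
          mul_le_mul hK1 hb2 (Nat.cast_nonneg _) (h0.trans hK1)
      _ ≤ _ := by
          have : 0 ≤ (B / ε ^ 2) * (Real.log m + Real.log (2 / δ)) := by
            apply mul_nonneg (by linarith); linarith
          linarith
  · intro ρ
    set good := {s : Fin (K * b) → StabState n | ∀ i,
      |medianOfMeans (shadowEstimate (O i)) ε K b s - (O i * ρ.mat).trace.re| ≤ ε} with hgood
    have hprob : IsProbabilityMeasure (stabLaw ρ (K * b)) := by
      unfold stabLaw; infer_instance
    have hbad : (stabLaw ρ (K * b)).real goodᶜ ≤ δ := by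
      have hsub : goodᶜ = ⋃ i, {s : Fin (K * b) → StabState n |
          ε < |medianOfMeans (shadowEstimate (O i)) ε K b s - (O i * ρ.mat).trace.re|} := by
        ext s; simp [hgood]
      rw [hsub]
      refine (measureReal_iUnion_fintype_le _).trans ?_
      refine (Finset.sum_le_card_nsmul _ _ ((1 / 2) ^ K) fun i _ => ?_).trans ?_
      · rw [← integral_shadowEstimate ρ (hO i)]
        refine medianOfMeans_fail _ _ hε K hb0 ?_
        have h1 := variance_shadowEstimate_le ρ (hO i)
        have h2 := hB i
        have h3 : 192 * B ≤ b * ε ^ 2 := by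
          rw [← mul_div_assoc, div_le_iff₀ (by positivity)] at hb1
          exact hb1
        linarith
      · rw [nsmul_eq_mul, Finset.card_univ]; exact hKδ
    have hc := probReal_compl_eq_one_sub (μ := stabLaw ρ (K * b)) (s := good)
      (Set.toFinite _).measurableSet
    linarith

end Shadow

/-! ### Tomography, constant predictions and the final bound -/

section Main

variable {n : ℕ}

theorem vecMulVec_star_isHermitian (w : Bits n → ℂ) :
    (Matrix.vecMulVec w (star w)).IsHermitian := by
  rw [Matrix.IsHermitian, Matrix.conjTranspose_vecMulVec, star_star]

theorem trace_vecMulVec_star_mul (w : Bits n → ℂ) (A : QMat n) :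
    (Matrix.vecMulVec w (star w) * A).trace = star w ⬝ᵥ A.mulVec w := by
  rw [Matrix.vecMulVec_mul, Matrix.trace_vecMulVec, dotProduct_comm, ← Matrix.dotProduct_mulVec]

theorem trace_vecMulVec_star_sq {w : Bits n → ℂ} (hw : star w ⬝ᵥ w = 1) :
    (Matrix.vecMulVec w (star w) * Matrix.vecMulVec w (star w)).trace = 1 := by
  rw [Matrix.vecMulVec_mul_vecMulVec, hw, one_smul, Matrix.trace_vecMulVec, dotProduct_comm, hw]

theorem lower_bound_log_two_div {δ : ℝ} (hδ : 0 < δ) (hδ1 : δ ≤ 1) : 0.69 ≤ Real.log (2 / δ) := by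
  have h1 := Real.log_two_gt_d9
  have h2 : Real.log 2 ≤ Real.log (2 / δ) :=
    Real.log_le_log (by norm_num) (by rw [le_div_iff₀ hδ]; linarith)
  linarith

/-- State tomography with stabilizer measurements. -/
theorem exists_tomography (n : ℕ) {τ δ : ℝ} (hτ : 0 < τ) (hτ1 : τ ≤ 1) (hδ : 0 < δ) (hδ1 : δ ≤ 1) :
    ∃ N : ℕ, (N : ℝ) ≤ 2800 * (2 ^ n / τ ^ 2) * Real.log (2 / δ) ∧
      ∃ est : (Fin N → StabState n) → QMat n, ∀ ρ : QState n,
        1 - δ ≤ (stabLaw ρ N).real {s | (est s).IsHermitian ∧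
          ((est s - ρ.mat) * (est s - ρ.mat)).trace.re ≤ min (8 * τ) (16 * 2 ^ n * τ ^ 2)} := by
  classical
  obtain ⟨T, hcard, hne, hunit, hcov⟩ := exists_bits_net n
  have : Nonempty T := hne.to_subtype
  -- Rank-one projectors of unit vectors have `tr (P ^ 2) = 1`, so the bound on the observables is
  -- `1` in every dimension.
  obtain ⟨N, hN, predict, hp⟩ := exists_predict_family
    (fun w : T => Matrix.vecMulVec (w : Bits n → ℂ) (star (w : Bits n → ℂ)))
    (fun w => vecMulVec_star_isHermitian _) (B := 1) (ε := τ) (δ := δ)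
    (fun w => by rw [trace_vecMulVec_star_sq (hunit w w.2), Complex.one_re]) hτ
    (by nlinarith) hδ hδ1
  let P : (Fin N → StabState n) → QState n → Prop := fun s σ => ∀ w : T,
    |predict s w - (Matrix.vecMulVec (w : Bits n → ℂ) (star (w : Bits n → ℂ)) * σ.mat).trace.re| ≤ τ
  -- The estimate is any state compatible with all predictions. On the good event `ρ` itself is
  -- compatible, so the default value 0 is never used there.
  refine ⟨N, hN.trans ?_, fun s => if h : ∃ σ, P s σ then h.choose.mat else 0, fun ρ => ?_⟩
  · have hd := lower_bound_log_two_div hδ hδ1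
    have hD : (1 : ℝ) ≤ 2 ^ n := one_le_pow₀ (by norm_num)
    have hlog : Real.log (Fintype.card T) ≤ 3.5 * 2 ^ n := by
      have h25 : Real.log 25 ≤ 3.5 := by
        have h1 : Real.log 25 ≤ Real.log (2 ^ 5) := Real.log_le_log (by norm_num) (by norm_num)
        rw [Real.log_pow] at h1
        have := Real.log_two_lt_d9
        push_cast at h1
        linarith
      have h1 : Real.log (Fintype.card T) ≤ Real.log ((25 : ℝ) ^ 2 ^ n) := by
        apply Real.log_le_log
        · exact_mod_cast (Fintype.card_pos : 0 < Fintype.card T)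
        · rw [Fintype.card_coe]; exact_mod_cast hcard
      rw [Real.log_pow] at h1
      push_cast at h1
      nlinarith
    have hτ2 : 0 < 1 / τ ^ 2 := by positivity
    have : Real.log (Fintype.card T) + Real.log (2 / δ) ≤ 7 * (2 ^ n * Real.log (2 / δ)) := by
      nlinarith
    calc _ ≤ 400 * (1 / τ ^ 2) * (7 * (2 ^ n * Real.log (2 / δ))) := by gcongr
      _ = _ := by ring
  · refine (hp ρ).trans ?_
    have : Finite (StabState n) := Finite.of_fintype _
    have hprob : IsProbabilityMeasure (stabLaw ρ N) := by
      unfold stabLaw; infer_instance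
    refine measureReal_mono ?_
    intro s hs
    have hex : ∃ σ, P s σ := ⟨ρ, hs⟩
    rw [Set.mem_ofPred_eq]
    beta_reduce
    rw [dif_pos hex]
    refine ⟨hex.choose.posSemidef.1, ?_⟩
    have hσ := hex.choose_spec
    set σ := hex.choose
    -- Both states are within `τ` of the same predictions, so the quadratic form of their difference
    -- is at most `2τ` on the net, and its eigenvalues at most `4τ`.
    have hev := eigenvalues_le_of_net (σ.sub_isHermitian ρ) hunit hcov (τ := 2 * τ) (fun w hw => by
      rw [← trace_vecMulVec_star_mul, mul_sub, Matrix.trace_sub, Complex.sub_re]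
      have h1 := abs_le.1 (hσ ⟨w, hw⟩)
      have h2 := abs_le.1 (hs ⟨w, hw⟩)
      rw [abs_le]
      constructor <;> linarith)
    refine (σ.trace_sub_sq_le ρ hev).trans (le_of_eq ?_)
    congr 1 <;> ring

/-- Every observable of bounded Frobenius norm is predicted accurately by an estimate of the state
in Frobenius norm. -/
theorem exists_predict_of_tomography {M : ℕ} (O : Fin M → QMat n) (hO : ∀ i, (O i).IsHermitian)
    {B ε τ δ : ℝ} (hB : ∀ i, (O i * O i).trace.re ≤ B) (hε : 0 < ε) (hτ : 0 < τ) (hτ1 : τ ≤ 1)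
    (hδ : 0 < δ) (hδ1 : δ ≤ 1) (hB0 : 0 ≤ B)
    (hτε : B * min (8 * τ) (16 * 2 ^ n * τ ^ 2) ≤ ε ^ 2) :
    ∃ N : ℕ, (N : ℝ) ≤ 2800 * (2 ^ n / τ ^ 2) * Real.log (2 / δ) ∧
      ∃ predict : (Fin N → StabState n) → Fin M → ℝ, ∀ ρ : QState n,
        1 - δ ≤ (stabLaw ρ N).real {s | ∀ i, |predict s i - (O i * ρ.mat).trace.re| ≤ ε} := by
  obtain ⟨N, hN, est, hest⟩ := exists_tomography n hτ hτ1 hδ hδ1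
  refine ⟨N, hN, fun s i => (O i * est s).trace.re, fun ρ => (hest ρ).trans ?_⟩
  have hprob : IsProbabilityMeasure (stabLaw ρ N) := by
    unfold stabLaw; infer_instance
  refine measureReal_mono ?_
  rintro s ⟨hs1, hs2⟩ i
  rw [← Complex.sub_re, ← Matrix.trace_sub, ← mul_sub]
  apply abs_le_of_sq_le_sq _ hε.le
  refine ((hO i).trace_mul_sq_le (hs1.sub ρ.posSemidef.1)).trans (le_trans ?_ hτε)
  exact mul_le_mul (hB i) hs2 (hs1.sub ρ.posSemidef.1).trace_mul_self_nonneg hB0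

/-- Observables of small Frobenius norm can be predicted without any measurement. -/
theorem exists_constant_prediction {O : QMat n} (hO : O.IsHermitian) {ε : ℝ} (hε : 0 < ε)
    (h : (O * O).trace.re ≤ 2 * ε ^ 2) :
    ∃ x : ℝ, ∀ ρ : QState n, |x - (O * ρ.mat).trace.re| ≤ ε := by
  have hdiff : ∀ ρ σ : QState n, (O * ρ.mat).trace.re ≤ (O * σ.mat).trace.re + 2 * ε := by
    intro ρ σ
    have h1 := hO.trace_mul_sq_le (ρ.sub_isHermitian σ)
    have h2 : (O * O).trace.re * ((ρ.mat - σ.mat) * (ρ.mat - σ.mat)).trace.re ≤ (2 * ε) ^ 2 :=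
      calc _ ≤ (2 * ε ^ 2) * 2 := mul_le_mul h (ρ.trace_sub_sq_le_two σ)
            (ρ.sub_isHermitian σ).trace_mul_self_nonneg (by positivity)
        _ = _ := by ring
    have h3 := (abs_le.1 (abs_le_of_sq_le_sq (h1.trans h2) (by positivity))).2
    rw [mul_sub, Matrix.trace_sub, Complex.sub_re] at h3
    linarith
  -- Over all states the expectation varies by at most `2ε`, as the squared Frobenius distance of
  -- two states is at most 2. The supremum minus `ε` is therefore within `ε` of every value.
  refine ⟨(⨆ ρ : QState n, (O * ρ.mat).trace.re) - ε, fun ρ => ?_⟩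
  have : Nonempty (QState n) := ⟨ρ⟩
  have hbdd : BddAbove (Set.range fun σ : QState n => (O * σ.mat).trace.re) := by
    refine ⟨(O * ρ.mat).trace.re + 2 * ε, ?_⟩
    rintro _ ⟨σ, rfl⟩
    exact hdiff σ ρ
  have h1 := le_ciSup hbdd ρ
  have h2 : (⨆ σ : QState n, (O * σ.mat).trace.re) ≤ (O * ρ.mat).trace.re + 2 * ε :=
    ciSup_le fun σ => hdiff σ ρ
  rw [abs_le]
  constructor <;> linarith

/-- Here the argument of the logarithm exceeds `√2`, and `log 2 / 2 > 1 / 3`. The tomography bounds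
have no logarithm, and this lets the one in the statement be inserted at the cost of a constant. -/
theorem le_posLog_sqrt_div {B ε : ℝ} (hε : 0 < ε) (hB : 2 * ε ^ 2 < B) :
    1 / 3 ≤ Real.posLog (Real.sqrt B / ε) := by
  have h0 : 0 < B := lt_of_le_of_lt (by positivity) hB
  have h1 : Real.sqrt 2 ≤ Real.sqrt B / ε := by
    rw [le_div_iff₀ hε]
    apply Real.le_sqrt_of_sq_le
    rw [mul_pow, Real.sq_sqrt (by norm_num)]
    exact hB.le
  have h2 : Real.log (Real.sqrt 2) ≤ Real.log (Real.sqrt B / ε) :=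
    Real.log_le_log (by positivity) h1
  rw [Real.log_sqrt (by norm_num)] at h2
  have h3 := Real.log_two_gt_d9
  have h4 : Real.log (Real.sqrt B / ε) ≤ Real.posLog (Real.sqrt B / ε) := le_max_right _ _
  linarith

end Main

theorem mainTheorem2 :
    ∃ C : ℝ, 0 < C ∧
      ∀ (n M : ℕ), 2 ≤ M →
      ∀ O : Fin M → QMat n, (∀ i, (O i).IsHermitian) →
      ∀ B D : ℝ, B = maxTrSq O → D = 2 ^ n →
      ∀ ε δ : ℝ, 0 < ε → ε ≤ 1 → 0 < δ → δ ≤ 1 →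
      ∃ N : ℕ,
        (N : ℝ) ≤ C * Real.log (2 / δ) *
          min (B * Real.log M / ε ^ 2)
            (min (B ^ 2 * D / ε ^ 4 * Real.posLog (Real.sqrt B / ε))
              (B * D ^ 2 / ε ^ 2 * Real.posLog (Real.sqrt (B * D) / ε))) ∧
        ∃ predict : (Fin N → StabState n) → Fin M → ℝ,
          ∀ ρ : QState n,
            1 - δ ≤ (stabLaw ρ N).real
              {s | ∀ i, |predict s i - (Matrix.trace (O i * ρ.mat)).re| ≤ ε} := by
  -- The largest demand is `3 * 2800 * 64 = 537600`, from the second term.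
  refine ⟨600000, by norm_num, ?_⟩
  intro n M hM O hO B D hBdef hD ε δ hε hε1 hδ hδ1
  have hBi : ∀ i, (O i * O i).trace.re ≤ B := fun i => by
    rw [hBdef]; exact le_ciSup (f := fun i => (O i * O i).trace.re) (Set.finite_range _).bddAbove i
  have hB0 : 0 ≤ B := (hO ⟨0, by omega⟩).trace_mul_self_nonneg.trans (hBi _)
  have hD1 : 1 ≤ D := by rw [hD]; exact one_le_pow₀ (by norm_num)
  have hd := lower_bound_log_two_div hδ hδ1
  have hM2 : 0.69 ≤ Real.log M := by
    have h1 := Real.log_two_gt_d9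
    have h2 : Real.log 2 ≤ Real.log M := Real.log_le_log (by norm_num) (by exact_mod_cast hM)
    linarith
  set d := Real.log (2 / δ) with hdd
  -- In the small case the bound may be zero because of `log⁺`, so the protocol must use no copies
  -- at all.
  rcases le_or_gt B (2 * ε ^ 2) with hsmall | hlarge
  · choose x hx using fun i => exists_constant_prediction (hO i) hε ((hBi i).trans hsmall)
    refine ⟨0, ?_, fun _ => x, fun ρ => ?_⟩
    · rw [Nat.cast_zero]
      have h1 := Real.posLog_nonneg (x := Real.sqrt B / ε)
      have h2 := Real.posLog_nonneg (x := Real.sqrt (B * D) / ε)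
      have h3 : 0 ≤ Real.log M := by linarith
      have h4 : 0 ≤ D := by linarith
      exact mul_nonneg (by positivity)
        (le_min (by positivity) (le_min (by positivity) (by positivity)))
    · have : {s : Fin 0 → StabState n | ∀ i, |x i - (O i * ρ.mat).trace.re| ≤ ε} = Set.univ :=
        Set.eq_univ_of_forall fun _ i => hx i ρ
      have hprob : IsProbabilityMeasure (stabLaw ρ 0) := by
        unfold stabLaw; infer_instance
      rw [this, probReal_univ]
      linarith
  have hε2 : 0 < ε ^ 2 := by positivity
  have hBpos : 0 < B := by linarith
  have hDpos : 0 < D := by linarith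
  have hfirst : ∃ N : ℕ, (N : ℝ) ≤ 600000 * d * (B * Real.log M / ε ^ 2) ∧
      ∃ predict : (Fin N → StabState n) → Fin M → ℝ, ∀ ρ : QState n,
        1 - δ ≤ (stabLaw ρ N).real {s | ∀ i, |predict s i - (O i * ρ.mat).trace.re| ≤ ε} := by
    have : Nonempty (Fin M) := ⟨⟨0, by omega⟩⟩
    obtain ⟨N, hN, h⟩ := exists_predict_family O hO hBi hε (by linarith) hδ hδ1
    refine ⟨N, hN.trans ?_, h⟩
    rw [Fintype.card_fin, ← hdd]
    have hr : 0 < B / ε ^ 2 := by positivity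
    -- The sum of logarithms becomes a product because both are bounded below by 0.69; this uses `M
    -- ≥ 2` and `δ ≤ 1`.
    have : Real.log M + d ≤ 3 * (d * Real.log M) := by nlinarith
    calc _ ≤ 400 * (B / ε ^ 2) * (3 * (d * Real.log M)) := by gcongr
      _ = 1200 * (d * (B * Real.log M / ε ^ 2)) := by ring
      _ ≤ 600000 * (d * (B * Real.log M / ε ^ 2)) := by
          have : 0 ≤ Real.log M := by linarith
          gcongr
          norm_num
      _ = _ := by ring
  have hsecond : ∃ N : ℕ,
      (N : ℝ) ≤ 600000 * d * (B ^ 2 * D / ε ^ 4 * Real.posLog (Real.sqrt B / ε)) ∧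
      ∃ predict : (Fin N → StabState n) → Fin M → ℝ, ∀ ρ : QState n,
        1 - δ ≤ (stabLaw ρ N).real {s | ∀ i, |predict s i - (O i * ρ.mat).trace.re| ≤ ε} := by
    -- This `τ` solves `B * 8τ = ε ^ 2`, using the dimension-free branch of the Frobenius bound.
    obtain ⟨N, hN, h⟩ := exists_predict_of_tomography O hO (τ := ε ^ 2 / (8 * B)) hBi hε
      (by positivity) (by rw [div_le_one (by positivity)]; linarith) hδ hδ1 hB0 (by
        refine (mul_le_mul_of_nonneg_left (min_le_left _ _) hB0).trans (le_of_eq ?_)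
        field_simp)
    refine ⟨N, hN.trans ?_, h⟩
    rw [← hD, ← hdd]
    have hl := le_posLog_sqrt_div hε hlarge
    calc 2800 * (D / (ε ^ 2 / (8 * B)) ^ 2) * d =
          600000 * d * (B ^ 2 * D / ε ^ 4 * (2800 * 64 / 600000)) := by
          field_simp
          norm_num
      _ ≤ _ := by
          gcongr
          refine le_trans ?_ hl
          norm_num
  have hthird : ∃ N : ℕ,
      (N : ℝ) ≤ 600000 * d * (B * D ^ 2 / ε ^ 2 * Real.posLog (Real.sqrt (B * D) / ε)) ∧
      ∃ predict : (Fin N → StabState n) → Fin M → ℝ, ∀ ρ : QState n,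
        1 - δ ≤ (stabLaw ρ N).real {s | ∀ i, |predict s i - (O i * ρ.mat).trace.re| ≤ ε} := by
    have hBD : 2 * ε ^ 2 < B * D := by nlinarith
    have hsq : Real.sqrt (B * D) ^ 2 = B * D := Real.sq_sqrt (by positivity)
    have hspos : 0 < Real.sqrt (B * D) := Real.sqrt_pos.2 (by positivity)
    -- This `τ` solves `B * 16 D τ ^ 2 = ε ^ 2`, using the branch that is quadratic in `τ`.
    obtain ⟨N, hN, h⟩ := exists_predict_of_tomography O hO (τ := ε / (4 * Real.sqrt (B * D))) hBi hε
      (by positivity) (by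
        rw [div_le_one (by positivity)]
        have : ε ≤ Real.sqrt (B * D) := Real.le_sqrt_of_sq_le (by linarith)
        linarith) hδ hδ1 hB0 (by
        refine (mul_le_mul_of_nonneg_left (min_le_right _ _) hB0).trans (le_of_eq ?_)
        rw [← hD, div_pow, mul_pow, hsq]
        field_simp
        norm_num)
    refine ⟨N, hN.trans ?_, h⟩
    rw [← hD, ← hdd, div_pow, mul_pow, hsq]
    have hl := le_posLog_sqrt_div hε hBD
    calc 2800 * (D / (ε ^ 2 / (4 ^ 2 * (B * D)))) * d =
          600000 * d * (B * D ^ 2 / ε ^ 2 * (2800 * 16 / 600000)) := by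
          field_simp
          norm_num
      _ ≤ _ := by
          gcongr
          refine le_trans ?_ hl
          norm_num
  -- The parameters are known in advance, so the protocol attaining the minimum can be selected.
  rcases min_choice (B * Real.log M / ε ^ 2)
      (min (B ^ 2 * D / ε ^ 4 * Real.posLog (Real.sqrt B / ε))
        (B * D ^ 2 / ε ^ 2 * Real.posLog (Real.sqrt (B * D) / ε))) with h | h <;> rw [h]
  · exact hfirst
  rcases min_choice (B ^ 2 * D / ε ^ 4 * Real.posLog (Real.sqrt B / ε))
      (B * D ^ 2 / ε ^ 2 * Real.posLog (Real.sqrt (B * D) / ε)) with h | h <;> rw [h]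
  · exact hsecond
  · exact hthird
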